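/- Let $n\ge 1$ and let $u\in\mathbb R^n$ with $|u|=1$. Let $\mathcal K_1(\mathbb R^d)$ be the space of all $\varphi\in C^\infty(\mathbb R^d)$ (complex-valued) for which all the norms $\rho_k(\varphi)=\sup_{t\in\mathbb R^d,\,|\alpha|\le k}e^{k|t|}|\varphi^{(\alpha)}(t)|$, $k\in\mathbb N_0$, are finite, and let $\mathcal U(\mathbb C^n)$ be the space of all entire functions $\psi$ on $\mathbb C^n$ for which all the norms $\theta_k(\psi)=\sup_{z\in\Pi_k}(1+|z|^2)^{k/2}|\psi(z)|$, $k\in\mathbb N_0$, are finite, where $\Pi_k=\mathbb R^n+i[-k,k]^n$; both spaces carry the topologies given by these norms. Let $\mathcal K_1(\mathbb R)\widehat\otimes\,\mathcal U(\mathbb C^n)$ be the completion of $\mathcal K_1(\mathbb R)\otimes\mathcal U(\mathbb C^n)$ in the projective ($\pi$-) topology; for an element $\Phi$ of it, $x\in\mathbb R$ and $z\in\mathbb C^n$, the value $\Phi(x,z)$ is given by the continuous linear extension of $\varphi\otimes\psi\mapsto\varphi(x)\psi(z)$. For $\Phi\in\mathcal K_1(\mathbb R)\widehat\otimes\,\mathcal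 U(\mathbb C^n)$ and $g\in\mathcal K_1(\mathbb R)$ put $$DS^*_{g,u}\Phi(t)=\int_{\mathbb R^n}\int_{\mathbb R}\Phi(x,\xi)\,g(u\cdot t-x)\,e^{2\pi i\,\xi\cdot t}\,dx\,d\xi,\qquad t\in\mathbb R^n .$$ Then the integrand is integrable on $\mathbb R^n\times\mathbb R$ for every $t$, the function $DS^*_{g,u}\Phi$ belongs to $\mathcal K_1(\mathbb R^n)$, and the map $(\Phi,g)\mapsto DS^*_{g,u}\Phi$ is bilinear and (jointly) continuous from $\big(\mathcal K_1(\mathbb R)\widehat\otimes\,\mathcal U(\mathbb C^n)\big)\times\mathcal K_1(\mathbb R)$ into $\mathcal K_1(\mathbb R^n)$. -/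

import Mathlib

open scoped ContDiff TensorProduct

noncomputable section

namespace DSTFT

/-! ### Seminorms given by suprema -/

/-- If `v ↦ f v i` is subadditive and absolutely homogeneous for every `i`, and the family
`f v` is bounded for every `v`, then `v ↦ sup_i f v i` is a seminorm. -/
def supSeminorm {V ι : Type*} [AddCommGroup V] [Module ℂ V] [Nonempty ι] (f : V → ι → ℝ)
    (hb : ∀ v, BddAbove (Set.range (f v)))
    (hadd : ∀ v w i, f (v + w) i ≤ f v i + f w i)
    (hsmul : ∀ (c : ℂ) v i, f (c • v) i = ‖c‖ * f v i) : Seminorm ℂ V :=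
  Seminorm.of (fun v => ⨆ i, f v i)
    (fun v w => ciSup_le fun i =>
      (hadd v w i).trans (add_le_add (le_ciSup (hb v) i) (le_ciSup (hb w) i)))
    (fun c v => by
      simp only [hsmul]
      exact (Real.mul_iSup_of_nonneg (norm_nonneg c) _).symm)

/-! ### The space `𝒦₁(E)` -/

section K1

variable (E : Type*) [NormedAddCommGroup E] [NormedSpace ℝ E]

/-- `e^{k|t|} |D^m φ(t)|`, indexed by the orders `m ≤ k` and the points `t`. -/
def rhoFun (k : ℕ) (φ : E → ℂ) (i : Fin (k + 1) × E) : ℝ :=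
  Real.exp (k * ‖i.2‖) * ‖iteratedFDeriv ℝ (i.1 : ℕ) φ i.2‖

variable {E}

lemma rhoFun_add (k : ℕ) {φ ψ : E → ℂ} (hφ : ContDiff ℝ ∞ φ) (hψ : ContDiff ℝ ∞ ψ)
    (i : Fin (k + 1) × E) : rhoFun E k (φ + ψ) i ≤ rhoFun E k φ i + rhoFun E k ψ i := by
  have h : iteratedFDeriv ℝ (i.1 : ℕ) (φ + ψ) i.2
      = iteratedFDeriv ℝ (i.1 : ℕ) φ i.2 + iteratedFDeriv ℝ (i.1 : ℕ) ψ i.2 :=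
    iteratedFDeriv_add_apply (hφ.of_le (by exact_mod_cast le_top)).contDiffAt
      (hψ.of_le (by exact_mod_cast le_top)).contDiffAt
  unfold rhoFun
  rw [h, ← mul_add]
  exact mul_le_mul_of_nonneg_left (norm_add_le _ _) (Real.exp_pos _).le

lemma rhoFun_smul (k : ℕ) {φ : E → ℂ} (hφ : ContDiff ℝ ∞ φ) (c : ℂ)
    (i : Fin (k + 1) × E) : rhoFun E k (c • φ) i = ‖c‖ * rhoFun E k φ i := by
  have h : iteratedFDeriv ℝ (i.1 : ℕ) (c • φ) i.2 = c • iteratedFDeriv ℝ (i.1 : ℕ) φ i.2 :=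
    iteratedFDeriv_const_smul_apply (hφ.of_le (by exact_mod_cast le_top)).contDiffAt
  unfold rhoFun
  rw [h, norm_smul]
  ring

variable (E)

/-- The exponentially rapidly decreasing smooth functions: smooth `φ : E → ℂ` such that
`sup_{t, m ≤ k} e^{k|t|} |D^m φ(t)| < ∞` for all `k`. -/
def K1Submodule : Submodule ℂ (E → ℂ) where
  carrier := {φ | ContDiff ℝ ∞ φ ∧ ∀ k : ℕ, BddAbove (Set.range (rhoFun E k φ))}
  zero_mem' := by
    refine ⟨contDiff_const, fun k => ⟨0, ?_⟩⟩
    rintro _ ⟨i, rfl⟩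
    have h := rhoFun_smul (E := E) k (φ := 0) contDiff_const 0 i
    simp only [smul_zero, norm_zero, zero_mul] at h
    exact h.le
  add_mem' := by
    rintro φ ψ ⟨hφ, hφb⟩ ⟨hψ, hψb⟩
    refine ⟨hφ.add hψ, fun k => ?_⟩
    obtain ⟨A, hA⟩ := hφb k
    obtain ⟨B, hB⟩ := hψb k
    refine ⟨A + B, ?_⟩
    rintro _ ⟨i, rfl⟩
    exact (rhoFun_add k hφ hψ i).trans (add_le_add (hA ⟨i, rfl⟩) (hB ⟨i, rfl⟩))
  smul_mem' := by
    rintro c φ ⟨hφ, hφb⟩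
    refine ⟨hφ.const_smul c, fun k => ?_⟩
    obtain ⟨A, hA⟩ := hφb k
    refine ⟨‖c‖ * A, ?_⟩
    rintro _ ⟨i, rfl⟩
    rw [rhoFun_smul k hφ c i]
    exact mul_le_mul_of_nonneg_left (hA ⟨i, rfl⟩) (norm_nonneg c)

/-- The space `𝒦₁(E)`, as a type of its own, so that it does not inherit the topology of
pointwise convergence. -/
def K1 : Type _ := ↥(K1Submodule E)

instance : AddCommGroup (K1 E) := inferInstanceAs (AddCommGroup ↥(K1Submodule E))
instance : Module ℂ (K1 E) := inferInstanceAs (Module ℂ ↥(K1Submodule E))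
instance : CoeFun (K1 E) (fun _ => E → ℂ) := ⟨fun φ => φ.1⟩

/-- The norms `ρ_k(φ) = sup_{t, m ≤ k} e^{k|t|} |D^m φ(t)|`. -/
def rho : SeminormFamily ℂ (K1 E) ℕ := fun k =>
  supSeminorm (fun φ : K1 E => rhoFun E k φ) (fun φ => φ.2.2 k)
    (fun φ ψ i => rhoFun_add k φ.2.1 ψ.2.1 i)
    (fun c φ i => rhoFun_smul k φ.2.1 c i)

/-- The topology of `𝒦₁(E)` is generated by the norms `ρ_k`. -/
instance : TopologicalSpace (K1 E) := (rho E).moduleFilterBasis.topology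

end K1

/-! ### The space `𝒰(ℂⁿ)` -/

section U

variable (n : ℕ)

/-- The tube `Π_k = ℝⁿ + i[-k,k]ⁿ`. -/
def tube (k : ℕ) : Set (EuclideanSpace ℂ (Fin n)) := {z | ∀ j, |(z j).im| ≤ k}

instance (k : ℕ) : Nonempty (tube n k) := ⟨⟨0, fun j => by simp⟩⟩

/-- `(1+|z|²)^{k/2} |ψ(z)|` on the tube `Π_k`. -/
def thetaFun (k : ℕ) (ψ : EuclideanSpace ℂ (Fin n) → ℂ) (z : tube n k) : ℝ :=
  (1 + ‖(z : EuclideanSpace ℂ (Fin n))‖ ^ 2) ^ ((k : ℝ) / 2) * ‖ψ z‖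

variable {n}

lemma thetaFun_add (k : ℕ) (ψ χ : EuclideanSpace ℂ (Fin n) → ℂ) (z : tube n k) :
    thetaFun n k (ψ + χ) z ≤ thetaFun n k ψ z + thetaFun n k χ z := by
  unfold thetaFun
  rw [← mul_add]
  exact mul_le_mul_of_nonneg_left (norm_add_le _ _) (by positivity)

lemma thetaFun_smul (k : ℕ) (c : ℂ) (ψ : EuclideanSpace ℂ (Fin n) → ℂ) (z : tube n k) :
    thetaFun n k (c • ψ) z = ‖c‖ * thetaFun n k ψ z := by
  unfold thetaFun
  rw [Pi.smul_apply, norm_smul]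
  ring

variable (n)

/-- The entire functions `ψ` on `ℂⁿ` with `sup_{z ∈ Π_k} (1+|z|²)^{k/2} |ψ(z)| < ∞` for all
`k`. -/
def USubmodule : Submodule ℂ (EuclideanSpace ℂ (Fin n) → ℂ) where
  carrier := {ψ | Differentiable ℂ ψ ∧ ∀ k : ℕ, BddAbove (Set.range (thetaFun n k ψ))}
  zero_mem' := by
    refine ⟨differentiable_const _, fun k => ⟨0, ?_⟩⟩
    rintro _ ⟨z, rfl⟩
    simp [thetaFun]
  add_mem' := by
    rintro ψ χ ⟨hψ, hψb⟩ ⟨hχ, hχb⟩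
    refine ⟨hψ.add hχ, fun k => ?_⟩
    obtain ⟨A, hA⟩ := hψb k
    obtain ⟨B, hB⟩ := hχb k
    refine ⟨A + B, ?_⟩
    rintro _ ⟨z, rfl⟩
    exact (thetaFun_add k ψ χ z).trans (add_le_add (hA ⟨z, rfl⟩) (hB ⟨z, rfl⟩))
  smul_mem' := by
    rintro c ψ ⟨hψ, hψb⟩
    refine ⟨hψ.const_smul c, fun k => ?_⟩
    obtain ⟨A, hA⟩ := hψb k
    refine ⟨‖c‖ * A, ?_⟩
    rintro _ ⟨z, rfl⟩
    rw [thetaFun_smul]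
    exact mul_le_mul_of_nonneg_left (hA ⟨z, rfl⟩) (norm_nonneg c)

/-- The space `𝒰(ℂⁿ)`. -/
def U : Type := ↥(USubmodule n)

instance : AddCommGroup (U n) := inferInstanceAs (AddCommGroup ↥(USubmodule n))
instance : Module ℂ (U n) := inferInstanceAs (Module ℂ ↥(USubmodule n))
instance : CoeFun (U n) (fun _ => EuclideanSpace ℂ (Fin n) → ℂ) := ⟨fun ψ => ψ.1⟩

/-- The norms `θ_k(ψ) = sup_{z ∈ Π_k} (1+|z|²)^{k/2} |ψ(z)|`. -/
def theta : SeminormFamily ℂ (U n) ℕ := fun k =>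
  supSeminorm (fun ψ : U n => thetaFun n k ψ) (fun ψ => ψ.2.2 k)
    (fun ψ χ z => thetaFun_add k ψ χ z) (fun c ψ z => thetaFun_smul k c ψ z)

/-- The topology of `𝒰(ℂⁿ)` is generated by the norms `θ_k`. -/
instance : TopologicalSpace (U n) := (theta n).moduleFilterBasis.topology

end U

/-! ### The projective tensor product of seminorms -/

section Projective

variable {V W : Type*} [AddCommGroup V] [Module ℂ V] [AddCommGroup W] [Module ℂ W]

/-- The numbers `∑ p(v_j) q(w_j)` over all representations `x = ∑ v_j ⊗ w_j`. -/
def projCosts (p : Seminorm ℂ V) (q : Seminorm ℂ W) (x : V ⊗[ℂ] W) : Set ℝ :=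
  {r | ∃ L : List (V × W), x = (L.map fun a => a.1 ⊗ₜ[ℂ] a.2).sum ∧
    r = (L.map fun a => p a.1 * q a.2).sum}

lemma projCosts_nonempty (p : Seminorm ℂ V) (q : Seminorm ℂ W) (x : V ⊗[ℂ] W) :
    (projCosts p q x).Nonempty := by
  induction x using TensorProduct.induction_on with
  | zero => exact ⟨_, [], by simp, rfl⟩
  | tmul v w => exact ⟨_, [(v, w)], by simp, rfl⟩
  | add x y hx hy =>
    obtain ⟨_, L, hL, -⟩ := hx
    obtain ⟨_, M, hM, -⟩ := hy
    exact ⟨_, L ++ M, by simp [hL, hM], rfl⟩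

lemma projCosts_nonneg (p : Seminorm ℂ V) (q : Seminorm ℂ W) (x : V ⊗[ℂ] W) :
    ∀ r ∈ projCosts p q x, 0 ≤ r := by
  rintro _ ⟨L, -, rfl⟩
  refine List.sum_nonneg ?_
  intro y hy
  obtain ⟨a, -, rfl⟩ := List.mem_map.1 hy
  exact mul_nonneg (apply_nonneg p _) (apply_nonneg q _)

lemma projCosts_bddBelow (p : Seminorm ℂ V) (q : Seminorm ℂ W) (x : V ⊗[ℂ] W) :
    BddBelow (projCosts p q x) := ⟨0, projCosts_nonneg p q x⟩

/-- The projective tensor product of two seminorms: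
`(p ⊗ q)(x) = inf {∑ p(v_j) q(w_j) : x = ∑ v_j ⊗ w_j}`. -/
def projSeminorm (p : Seminorm ℂ V) (q : Seminorm ℂ W) : Seminorm ℂ (V ⊗[ℂ] W) :=
  Seminorm.ofSMulLE (fun x => sInf (projCosts p q x))
    (le_antisymm (csInf_le (projCosts_bddBelow p q 0) ⟨[], by simp, by simp⟩)
      (le_csInf (projCosts_nonempty p q 0) (projCosts_nonneg p q 0)))
    (fun x y => by
      rw [← csInf_add (projCosts_nonempty p q x) (projCosts_bddBelow p q x)
        (projCosts_nonempty p q y) (projCosts_bddBelow p q y)]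
      refine csInf_le_csInf (projCosts_bddBelow p q _)
        ((projCosts_nonempty p q x).add (projCosts_nonempty p q y)) ?_
      rintro _ ⟨_, ⟨L, hL, rfl⟩, _, ⟨M, hM, rfl⟩, rfl⟩
      exact ⟨L ++ M, by simp [hL, hM], by simp⟩)
    (fun c x => by
      have key : ∀ r ∈ projCosts p q x, sInf (projCosts p q (c • x)) ≤ ‖c‖ * r := by
        rintro _ ⟨L, hL, rfl⟩
        refine csInf_le (projCosts_bddBelow p q _) ⟨L.map fun a => (c • a.1, a.2), ?_, ?_⟩
        · rw [hL, List.smul_sum, List.map_map, List.map_map]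
          rfl
        · rw [← List.sum_map_mul_left, List.map_map]
          refine congrArg List.sum (List.map_congr_left fun a _ => ?_)
          simp [map_smul_eq_mul, mul_assoc]
      rcases eq_or_lt_of_le (norm_nonneg c) with h | h
      · obtain ⟨r, hr⟩ := projCosts_nonempty p q x
        have := key r hr
        rw [← h, zero_mul] at this ⊢
        exact this
      · rw [mul_comm, ← div_le_iff₀ h]
        refine le_csInf (projCosts_nonempty p q x) fun r hr => ?_
        rw [div_le_iff₀ h, mul_comm]
        exact key r hr)

lemma projSeminorm_apply (p : Seminorm ℂ V) (q : Seminorm ℂ W) (x : V ⊗[ℂ] W) :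
    projSeminorm p q x = sInf (projCosts p q x) := rfl

end Projective

/-! ### The completed tensor product `𝒦₁(ℝ) ⊗̂ 𝒰(ℂⁿ)` -/

section Tensor

variable (n : ℕ)

/-- The algebraic tensor product `𝒦₁(ℝ) ⊗ 𝒰(ℂⁿ)`, carrying the `π`-topology below. -/
def K1TensorU : Type := K1 ℝ ⊗[ℂ] U n

instance : AddCommGroup (K1TensorU n) := inferInstanceAs (AddCommGroup (K1 ℝ ⊗[ℂ] U n))
instance : Module ℂ (K1TensorU n) := inferInstanceAs (Module ℂ (K1 ℝ ⊗[ℂ] U n))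

/-- The seminorms `ρ_k ⊗ θ_l`, which generate the `π`-topology. -/
def piSeminorm : SeminormFamily ℂ (K1TensorU n) (ℕ × ℕ) := fun i =>
  (projSeminorm (rho ℝ i.1) (theta n i.2) : Seminorm ℂ (K1 ℝ ⊗[ℂ] U n))

/-- The `π`-topology. -/
instance : TopologicalSpace (K1TensorU n) := (piSeminorm n).moduleFilterBasis.topology

lemma piSeminorm_withSeminorms : WithSeminorms (piSeminorm n) := ⟨rfl⟩

instance : IsTopologicalAddGroup (K1TensorU n) :=
  (piSeminorm_withSeminorms n).topologicalAddGroup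

instance : ContinuousSMul ℂ (K1TensorU n) := (piSeminorm_withSeminorms n).continuousSMul

instance : UniformSpace (K1TensorU n) := IsTopologicalAddGroup.rightUniformSpace _

instance : IsUniformAddGroup (K1TensorU n) := isUniformAddGroup_of_addCommGroup

instance : UniformContinuousConstSMul ℂ (K1TensorU n) :=
  uniformContinuousConstSMul_of_continuousConstSMul _ _

/-- The completed tensor product `𝒦₁(ℝ) ⊗̂ 𝒰(ℂⁿ)`. -/
abbrev K1HatU : Type := UniformSpace.Completion (K1TensorU n)

variable {n}

/-- Point evaluation on the algebraic tensor product, as a linear map: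
`φ ⊗ ψ ↦ φ(x) ψ(z)`. -/
def evalLin (x : ℝ) (z : EuclideanSpace ℂ (Fin n)) : K1TensorU n →ₗ[ℂ] ℂ :=
  (TensorProduct.lift (LinearMap.mk₂ ℂ (fun (φ : K1 ℝ) (ψ : U n) => φ x * ψ z)
    (fun _ _ _ => add_mul _ _ _) (fun _ _ _ => mul_assoc _ _ _)
    (fun _ _ _ => mul_add _ _ _) (fun _ _ _ => mul_left_comm _ _ _)) :
    K1 ℝ ⊗[ℂ] U n →ₗ[ℂ] ℂ)

lemma norm_apply_le_rho (φ : K1 ℝ) (x : ℝ) : ‖φ x‖ ≤ rho ℝ 0 φ := by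
  have h : rhoFun ℝ 0 φ (0, x) ≤ rho ℝ 0 φ := le_ciSup (φ.2.2 0) ((0, x) : Fin 1 × ℝ)
  simpa [rhoFun] using h

lemma norm_apply_le_theta (ψ : U n) {k : ℕ} {z : EuclideanSpace ℂ (Fin n)}
    (hz : z ∈ tube n k) : ‖ψ z‖ ≤ theta n k ψ := by
  have h : thetaFun n k ψ ⟨z, hz⟩ ≤ theta n k ψ := le_ciSup (ψ.2.2 k) ⟨z, hz⟩
  refine le_trans ?_ h
  refine le_mul_of_one_le_left (norm_nonneg _) (Real.one_le_rpow ?_ (by positivity))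
  exact le_add_of_nonneg_right (sq_nonneg _)

lemma exists_mem_tube (z : EuclideanSpace ℂ (Fin n)) : ∃ k : ℕ, z ∈ tube n k := by
  obtain ⟨k, hk⟩ := exists_nat_ge ‖z‖
  exact ⟨k, fun j => (Complex.abs_im_le_norm _).trans ((PiLp.norm_apply_le z j).trans hk)⟩

lemma norm_evalLin_le (x : ℝ) {k : ℕ} {z : EuclideanSpace ℂ (Fin n)} (hz : z ∈ tube n k)
    (y : K1TensorU n) : ‖evalLin x z y‖ ≤ piSeminorm n (0, k) y := by
  refine le_csInf (projCosts_nonempty (rho ℝ 0) (theta n k) y) ?_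
  rintro _ ⟨L, hL, rfl⟩
  have hsum : ∀ L : List (K1 ℝ × U n),
      ‖evalLin x z ((L.map fun a => a.1 ⊗ₜ[ℂ] a.2).sum : K1 ℝ ⊗[ℂ] U n)‖
        ≤ (L.map fun a => rho ℝ 0 a.1 * theta n k a.2).sum := by
    intro L
    induction L with
    | nil => exact (norm_le_zero_iff.2 (map_zero (evalLin x z)))
    | cons a L ih =>
      rw [List.map_cons, List.map_cons, List.sum_cons, List.sum_cons]
      refine (congrArg norm (map_add (evalLin x z) _ _)).le.trans ?_
      refine (norm_add_le _ _).trans (add_le_add ?_ ih)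
      have : evalLin x z (a.1 ⊗ₜ[ℂ] a.2 : K1 ℝ ⊗[ℂ] U n) = a.1 x * a.2 z := rfl
      rw [this, norm_mul]
      exact mul_le_mul (norm_apply_le_rho _ _) (norm_apply_le_theta _ hz) (norm_nonneg _)
        (apply_nonneg _ _)
  have := hsum L
  rwa [← hL] at this

lemma continuous_evalLin (x : ℝ) (z : EuclideanSpace ℂ (Fin n)) :
    Continuous (evalLin x z) := by
  obtain ⟨k, hk⟩ := exists_mem_tube z
  refine (piSeminorm_withSeminorms n).continuous_normedSpace_rng ℂ (evalLin x z) ?_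
  exact ⟨{(0, k)}, 1, fun y => by simpa using norm_evalLin_le x hk y⟩

/-- The value `Φ(x, z)` of an element of `𝒦₁(ℝ) ⊗̂ 𝒰(ℂⁿ)`: the continuous linear extension of
`φ ⊗ ψ ↦ φ(x) ψ(z)` to the completion. -/
def evalHat (x : ℝ) (z : EuclideanSpace ℂ (Fin n)) : K1HatU n →L[ℂ] ℂ :=
  ContinuousLinearMap.fromCompletion ⟨evalLin x z, continuous_evalLin x z⟩

lemma evalHat_tmul (x : ℝ) (z : EuclideanSpace ℂ (Fin n)) (φ : K1 ℝ) (ψ : U n) :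
    evalHat x z (UniformSpace.Completion.coe' (show K1TensorU n from φ ⊗ₜ[ℂ] ψ)) = φ x * ψ z :=
  ContinuousLinearMap.fromCompletion_apply_coe _ _

end Tensor

/-! ### The directional synthesis operator -/

variable {n : ℕ}

/-- The inclusion of `ℝⁿ` into `ℂⁿ`. -/
def toComplex (ξ : EuclideanSpace ℝ (Fin n)) : EuclideanSpace ℂ (Fin n) :=
  WithLp.toLp 2 fun j => (ξ j : ℂ)

/-- The integrand `Φ(x, ξ) g(u·t - x) e^{2πi ξ·t}` of the directional synthesis operator. -/
def synthesisKernel (u : EuclideanSpace ℝ (Fin n)) (g : K1 ℝ) (Φ : K1HatU n)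
    (t : EuclideanSpace ℝ (Fin n)) (ξ : EuclideanSpace ℝ (Fin n)) (x : ℝ) : ℂ :=
  evalHat x (toComplex ξ) Φ * g (inner ℝ u t - x)
    * Complex.exp (2 * Real.pi * Complex.I * (inner ℝ ξ t : ℝ))

/-- `DS*_{g,u} Φ(t) = ∫_{ℝⁿ} ∫_ℝ Φ(x, ξ) g(u·t - x) e^{2πi ξ·t} dx dξ`. -/
def synthesis (u : EuclideanSpace ℝ (Fin n)) (g : K1 ℝ) (Φ : K1HatU n)
    (t : EuclideanSpace ℝ (Fin n)) : ℂ :=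
  ∫ ξ : EuclideanSpace ℝ (Fin n), ∫ x : ℝ, synthesisKernel u g Φ t ξ x

end DSTFT

end

/-!
On a simple tensor the iterated integral factors: with `ψ̌` the inverse Fourier transform of `ψ`
restricted to `ℝⁿ`,
`DS*_{g,u}(φ ⊗ ψ)(t) = (φ * g)(u·t) ψ̌(t)`.
The factor `(φ * g)(u·t)` has bounded derivatives but in general no decay, since it is constant in
the directions orthogonal to `u`. All the decay comes from `ψ̌`: moving the domain of integration
from `ℝⁿ` to `ℝⁿ + iη` with `η_j = k sign(t_j)` turns the exponential into one of absolute value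
`e^{-2πη·t} ≤ e^{-k|t|}` (`integral_toComplex_add_smul`, `exp_mul_norm_invFourier_le`). The shift is
legitimate because `w ↦ ∫ F(ξ + wη) dξ` is an entire function of `w ∈ ℂ` which is constant on the
real axis. Derivatives of `ψ̌` amount to multiplying `ψ` by polynomials, which `𝒰(ℂⁿ)` tolerates.
Altogether `ρ_k(DS*(φ ⊗ ψ)) ≤ C ρ_k(g) ρ_1(φ) θ_{2k+n+1}(ψ)` (`rho_synthesisSimple_le`), hence
`ρ_k(DS* y) ≤ C ρ_k(g) (ρ_1 ⊗ θ_{2k+n+1})(y)` on the algebraic tensor product, and the bilinear map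
`(y, g) ↦ DS*_{g,u} y` is jointly continuous there (`continuous_synthesisAlg`).

As `𝒦₁(ℝⁿ)` is complete and Hausdorff, this map extends to a jointly continuous one on the
completion. It remains to see that the extension is still given by the integral. For this,
`y ↦ (1+x²)(1+|ξ|²)^{(n+1)/2} y(x, ξ)` is continuous from the `π`-topology to the bounded continuous
functions on `ℝⁿ × ℝ`, so it extends to the completion (`weighted`); this bounds the integrand by an
integrable function, and shows that for fixed `g` and `t` the integral is continuous in `Φ`
(`continuous_synthesis`). It therefore agrees with the extension, because it does so on a dense
subspace (`exists_continuous_eq_synthesis`).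
-/

noncomputable section

namespace DSTFT

open MeasureTheory Filter Topology

/-! ### The spaces `𝒦₁(E)` are complete -/

section K1Complete

variable {E : Type*} [NormedAddCommGroup E] [NormedSpace ℝ E]

lemma exp_mul_norm_iteratedFDeriv_le_rho (φ : K1 E) {k m : ℕ} (hm : m ≤ k) (t : E) :
    Real.exp (k * ‖t‖) * ‖iteratedFDeriv ℝ m φ t‖ ≤ rho E k φ :=
  le_ciSup (φ.2.2 k) ((⟨m, Nat.lt_succ_of_le hm⟩, t) : Fin (k + 1) × E)

lemma rho_le {φ : K1 E} {k : ℕ} {C : ℝ}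
    (h : ∀ m ≤ k, ∀ t, Real.exp (k * ‖t‖) * ‖iteratedFDeriv ℝ m φ t‖ ≤ C) : rho E k φ ≤ C :=
  ciSup_le fun i => h i.1 (Nat.lt_succ_iff.1 i.1.2) i.2

lemma norm_iteratedFDeriv_le_rho (φ : K1 E) {k m : ℕ} (hm : m ≤ k) (t : E) :
    ‖iteratedFDeriv ℝ m φ t‖ ≤ rho E k φ :=
  (le_mul_of_one_le_left (norm_nonneg _) (Real.one_le_exp (by positivity))).trans
    (exp_mul_norm_iteratedFDeriv_le_rho φ hm t)

lemma exp_mul_norm_le_rho (φ : K1 E) (k : ℕ) (t : E) :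
    Real.exp (k * ‖t‖) * ‖φ t‖ ≤ rho E k φ := by
  simpa using exp_mul_norm_iteratedFDeriv_le_rho φ (Nat.zero_le k) t

lemma rho_mono {k l : ℕ} (h : k ≤ l) (φ : K1 E) : rho E k φ ≤ rho E l φ :=
  rho_le fun _ hm t => le_trans (by gcongr)
    (exp_mul_norm_iteratedFDeriv_le_rho φ (hm.trans h) t)

/-- A smooth function with the required decay estimates, as an element of `𝒦₁(E)`. -/
def K1.ofBound (f : E → ℂ) (hf : ContDiff ℝ ∞ f) (C : ℕ → ℝ)
    (h : ∀ k m : ℕ, m ≤ k → ∀ t, Real.exp (k * ‖t‖) * ‖iteratedFDeriv ℝ m f t‖ ≤ C k) : K1 E :=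
  ⟨f, hf, fun k => ⟨C k, by
    rintro _ ⟨i, rfl⟩
    exact h k i.1 (Nat.lt_succ_iff.1 i.1.2) i.2⟩⟩

@[ext]
lemma K1.ext {φ ψ : K1 E} (h : ∀ t, φ t = ψ t) : φ = ψ := Subtype.ext (funext h)

/-- Evaluation at a point, as a linear form on `𝒦₁(E)`. -/
def K1.evalₗ (t : E) : K1 E →ₗ[ℂ] ℂ where
  toFun φ := φ t
  map_add' _ _ := rfl
  map_smul' _ _ := rfl

lemma K1.sub_apply (φ ψ : K1 E) (t : E) : (φ - ψ) t = φ t - ψ t := rfl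

lemma K1.sum_apply {ι : Type*} (s : Finset ι) (f : ι → K1 E) (t : E) :
    (∑ i ∈ s, f i) t = ∑ i ∈ s, f i t := map_sum (K1.evalₗ t) f s

lemma K1.contDiff (φ : K1 E) : ContDiff ℝ ∞ φ := φ.2.1

lemma K1.continuous (φ : K1 E) : Continuous φ := φ.contDiff.continuous

variable (E) in
lemma rho_withSeminorms : WithSeminorms (rho E) := ⟨rfl⟩

instance : IsTopologicalAddGroup (K1 E) := (rho_withSeminorms E).topologicalAddGroup

instance : UniformSpace (K1 E) := IsTopologicalAddGroup.rightUniformSpace _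

instance : IsUniformAddGroup (K1 E) := isUniformAddGroup_of_addCommGroup

lemma K1.continuous_evalₗ (t : E) : Continuous (K1.evalₗ t) := by
  refine (rho_withSeminorms E).continuous_normedSpace_rng ℂ (K1.evalₗ t) ⟨{0}, 1, fun φ => ?_⟩
  have := exp_mul_norm_le_rho φ 0 t
  simp only [Nat.cast_zero, zero_mul, Real.exp_zero, one_mul] at this
  simpa using! this

instance : T1Space (K1 E) := (rho_withSeminorms E).T1_of_separating fun φ hφ => by
  by_contra! h
  refine hφ (K1.ext fun t => ?_)
  have := exp_mul_norm_le_rho φ 0 t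
  rw [h 0] at this
  simpa using! this

/-- A series in `𝒦₁(E)` that converges absolutely for every `ρ_k` has a pointwise sum in `𝒦₁(E)`,
which satisfies the triangle inequality for every `ρ_k`. -/
lemma K1.exists_hasSum_apply {d : ℕ → K1 E} (hd : ∀ k, Summable fun i => rho E k (d i)) :
    ∃ s : K1 E, (∀ t, HasSum (fun i => d i t) (s t)) ∧ ∀ k, rho E k s ≤ ∑' i, rho E k (d i) := by
  have hcd : ∀ i, ContDiff ℝ (⊤ : ℕ∞) (d i) := fun i => (d i).contDiff
  have hb : ∀ (k i : ℕ) (x : E), (k : ℕ∞) ≤ (⊤ : ℕ∞) →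
      ‖iteratedFDeriv ℝ k (d i) x‖ ≤ rho E k (d i) :=
    fun k i x _ => norm_iteratedFDeriv_le_rho (d i) le_rfl x
  have hbound : ∀ k m : ℕ, m ≤ k → ∀ t, Real.exp (k * ‖t‖) *
      ‖iteratedFDeriv ℝ m (fun y => ∑' i, d i y) t‖ ≤ ∑' i, rho E k (d i) := by
    intro k m hm t
    rw [iteratedFDeriv_tsum_apply hcd (fun k _ => hd k) hb le_top t]
    have hs : Summable fun i => ‖iteratedFDeriv ℝ m (d i) t‖ :=
      (hd m).of_nonneg_of_le (fun _ => norm_nonneg _) fun i => hb m i t le_top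
    refine (mul_le_mul_of_nonneg_left (norm_tsum_le_tsum_norm hs) (Real.exp_pos _).le).trans ?_
    rw [← tsum_mul_left]
    exact (hs.mul_left _).tsum_le_tsum
      (fun i => exp_mul_norm_iteratedFDeriv_le_rho (d i) hm t) (hd k)
  refine ⟨K1.ofBound _ (contDiff_tsum hcd (fun k _ => hd k) hb) _ hbound, fun t => ?_,
    fun k => rho_le (hbound k)⟩
  refine Summable.hasSum ((hd 0).of_norm_bounded fun i => ?_)
  simpa using exp_mul_norm_le_rho (d i) 0 t

lemma K1.exists_tendsto_sum {d : ℕ → K1 E} (hd : ∀ k, Summable fun i => rho E k (d i)) :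
    ∃ s : K1 E, Tendsto (fun N => ∑ i ∈ Finset.range N, d i) atTop (𝓝 s) := by
  obtain ⟨s, hs, -⟩ := K1.exists_hasSum_apply hd
  refine ⟨s, ((rho_withSeminorms E).tendsto_nhds _ _).2 fun k ε hε => ?_⟩
  have htail : ∀ N, rho E k (∑ i ∈ Finset.range N, d i - s) ≤ ∑' i, rho E k (d (i + N)) := by
    intro N
    obtain ⟨r, hr, hrk⟩ := K1.exists_hasSum_apply (d := fun i => d (i + N))
      fun k => (summable_nat_add_iff N).2 (hd k)
    have hrs : s - ∑ i ∈ Finset.range N, d i = r := by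
      refine K1.ext fun t => ?_
      have h1 := (hasSum_nat_add_iff (f := fun i => d i t) N).1 (hr t)
      rw [K1.sub_apply, K1.sum_apply, (hs t).unique h1]
      exact add_sub_cancel_right _ _
    rw [← neg_sub, map_neg_eq_map, hrs]
    exact hrk k
  filter_upwards [(tendsto_order.1 (tendsto_sum_nat_add fun i => rho E k (d i))).2 ε hε] with N hN
  exact (htail N).trans_lt hN

instance : FirstCountableTopology (K1 E) := (rho_withSeminorms E).firstCountableTopology

instance : CompleteSpace (K1 E) := by
  have := IsUniformAddGroup.uniformity_countably_generated (α := K1 E)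
  refine UniformSpace.complete_of_convergent_controlled_sequences
    (fun N => {p | rho E N (p.2 - p.1) < (1 / 2) ^ N}) (fun N => ?_) fun u hu => ?_
  · rw [uniformity_eq_comap_nhds_zero]
    refine ⟨{v | rho E N v < (1 / 2) ^ N}, ?_, fun p hp => hp⟩
    refine (isOpen_lt ((rho_withSeminorms E).continuous_seminorm N) continuous_const).mem_nhds ?_
    simp
  · -- A controlled sequence is the sequence of partial sums of an absolutely convergent series.
    have hd : ∀ k, Summable fun i => rho E k (u (i + 1) - u i) := fun k => by
      rw [← summable_nat_add_iff k]
      refine Summable.of_nonneg_of_le (fun _ => apply_nonneg _ _) (fun i => ?_)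
        ((summable_nat_add_iff k).2 summable_geometric_two)
      exact (rho_mono (by omega) _).trans (hu (i + k) (i + k) (i + k + 1) le_rfl (by omega)).le
    obtain ⟨s, hs⟩ := K1.exists_tendsto_sum hd
    refine ⟨s + u 0, ?_⟩
    have := hs.add_const (u 0)
    simp only [Finset.sum_range_sub, sub_add_cancel] at this
    exact this

end K1Complete

/-! ### The norms `θ_k` -/

section Theta

variable {n : ℕ}

lemma tube_mono {k l : ℕ} (h : k ≤ l) : tube n k ⊆ tube n l :=
  fun _ hz j => (hz j).trans (by exact_mod_cast h)

lemma weight_mul_norm_le_theta (ψ : U n) {k : ℕ} {z : EuclideanSpace ℂ (Fin n)}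
    (hz : z ∈ tube n k) : (1 + ‖z‖ ^ 2) ^ ((k : ℝ) / 2) * ‖ψ z‖ ≤ theta n k ψ :=
  le_ciSup (ψ.2.2 k) ⟨z, hz⟩

lemma theta_le {ψ : U n} {k : ℕ} {C : ℝ}
    (h : ∀ z ∈ tube n k, (1 + ‖z‖ ^ 2) ^ ((k : ℝ) / 2) * ‖ψ z‖ ≤ C) : theta n k ψ ≤ C :=
  ciSup_le fun z => h z z.2

lemma weight_mul_norm_le_theta_of_le (ψ : U n) {k l : ℕ} (hkl : k ≤ l)
    {z : EuclideanSpace ℂ (Fin n)} (hz : z ∈ tube n l) :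
    (1 + ‖z‖ ^ 2) ^ ((k : ℝ) / 2) * ‖ψ z‖ ≤ theta n l ψ := by
  refine le_trans ?_ (weight_mul_norm_le_theta ψ hz)
  gcongr
  exact le_add_of_nonneg_right (sq_nonneg _)

lemma theta_mono {k l : ℕ} (h : k ≤ l) (ψ : U n) : theta n k ψ ≤ theta n l ψ :=
  theta_le fun _ hz => weight_mul_norm_le_theta_of_le ψ h (tube_mono h hz)

end Theta

/-! ### The embedding of `ℝⁿ` into `ℂⁿ` -/

section Embedding

variable {n : ℕ}

@[simp]
lemma toComplex_apply (ξ : EuclideanSpace ℝ (Fin n)) (j : Fin n) : toComplex ξ j = (ξ j : ℂ) := rfl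

@[simp]
lemma norm_toComplex (ξ : EuclideanSpace ℝ (Fin n)) : ‖toComplex ξ‖ = ‖ξ‖ := by
  simp [EuclideanSpace.norm_eq]

lemma toComplex_add (ξ η : EuclideanSpace ℝ (Fin n)) :
    toComplex (ξ + η) = toComplex ξ + toComplex η := by
  ext j; simp

lemma toComplex_smul (a : ℝ) (ξ : EuclideanSpace ℝ (Fin n)) :
    toComplex (a • ξ) = (a : ℂ) • toComplex ξ := by
  ext j; simp

@[fun_prop]
lemma continuous_toComplex : Continuous (toComplex (n := n)) := by
  unfold toComplex
  fun_prop

lemma inner_toComplex (t : EuclideanSpace ℝ (Fin n)) (z : EuclideanSpace ℂ (Fin n)) :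
    inner ℂ (toComplex t) z = ∑ j, (t j : ℂ) * z j := by
  simp [PiLp.inner_apply, mul_comm]

lemma inner_toComplex_toComplex (s t : EuclideanSpace ℝ (Fin n)) :
    inner ℂ (toComplex s) (toComplex t) = ((inner ℝ s t : ℝ) : ℂ) := by
  simp [PiLp.inner_apply, mul_comm]

lemma toComplex_mem_tube (ξ : EuclideanSpace ℝ (Fin n)) (k : ℕ) : toComplex ξ ∈ tube n k :=
  fun j => by simp

lemma norm_le_norm_toComplex_add_I_smul (ξ η : EuclideanSpace ℝ (Fin n)) :
    ‖ξ‖ ≤ ‖toComplex ξ + Complex.I • toComplex η‖ := by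
  rw [EuclideanSpace.norm_eq, EuclideanSpace.norm_eq]
  refine Real.sqrt_le_sqrt (Finset.sum_le_sum fun j _ => ?_)
  have h := Complex.abs_re_le_norm ((toComplex ξ + Complex.I • toComplex η) j)
  have hre : ((toComplex ξ + Complex.I • toComplex η) j).re = ξ j := by simp
  rw [hre] at h
  rw [Real.norm_eq_abs]
  gcongr

lemma norm_le_sum_abs (t : EuclideanSpace ℝ (Fin n)) : ‖t‖ ≤ ∑ j, |t j| := by
  rw [EuclideanSpace.norm_eq]
  refine Real.sqrt_le_iff.2 ⟨by positivity, ?_⟩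
  simpa using Finset.sum_sq_le_sq_sum_of_nonneg (s := Finset.univ) (f := fun j => |t j|)
    fun _ _ => abs_nonneg _

lemma abs_im_inner_toComplex_le (t : EuclideanSpace ℝ (Fin n)) {k : ℕ}
    {z : EuclideanSpace ℂ (Fin n)} (hz : z ∈ tube n k) :
    |(inner ℂ (toComplex t) z).im| ≤ (∑ j, |t j|) * k := by
  rw [inner_toComplex, Complex.im_sum, Finset.sum_mul]
  refine (Finset.abs_sum_le_sum_abs _ _).trans (Finset.sum_le_sum fun j _ => ?_)
  rw [Complex.im_ofReal_mul, abs_mul]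
  exact mul_le_mul_of_nonneg_left (hz j) (abs_nonneg _)

lemma norm_cexp_two_pi_I_mul (c : ℂ) :
    ‖Complex.exp (2 * Real.pi * Complex.I * c)‖ = Real.exp (-(2 * Real.pi * c.im)) := by
  rw [Complex.norm_exp]
  congr 1
  simp

end Embedding

/-! ### Shifting the domain of integration -/

section Shift

variable {n : ℕ}

variable (n) in
/-- The integrable weight `(1+|ξ|²)^{-(n+1)/2}` on `ℝⁿ`. -/
def decay (ξ : EuclideanSpace ℝ (Fin n)) : ℝ := (1 + ‖ξ‖ ^ 2) ^ (-(n + 1 : ℝ) / 2)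

lemma decay_pos (ξ : EuclideanSpace ℝ (Fin n)) : 0 < decay n ξ := by
  unfold decay
  positivity

lemma integrable_decay : Integrable (decay n) :=
  integrable_rpow_neg_one_add_norm_sq (by simp)

lemma continuous_decay : Continuous (decay n) := by
  unfold decay
  exact Continuous.rpow_const (by fun_prop) fun ξ => Or.inl (by positivity)

/-- An entire function that decays on every tube decays locally uniformly in `w` on the
translates `ℝⁿ + wη`. -/
lemma exists_norm_translate_le {F : EuclideanSpace ℂ (Fin n) → ℂ}
    (hb : ∀ K : ℕ, ∃ C, ∀ z ∈ tube n K, ‖F z‖ ≤ C * (1 + ‖z‖ ^ 2) ^ (-(n + 1 : ℝ) / 2))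
    (η : EuclideanSpace ℝ (Fin n)) (R : ℝ) :
    ∃ C, ∀ (w : ℂ) (ξ : EuclideanSpace ℝ (Fin n)), ‖w‖ ≤ R →
      ‖F (toComplex ξ + w • toComplex η)‖ ≤ C * decay n ξ := by
  obtain ⟨K, hK⟩ := exists_nat_ge (R * ‖η‖)
  obtain ⟨C, hC⟩ := hb K
  have hC0 : 0 ≤ C := by
    have h0 := (norm_nonneg _).trans (hC 0 fun j => by simp)
    simpa using h0
  set b := R * ‖η‖ with hbdef
  refine ⟨C * (2 * (1 + b ^ 2)) ^ ((n + 1 : ℝ) / 2), fun w ξ hw => ?_⟩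
  have hwη : ‖w‖ * ‖η‖ ≤ b := mul_le_mul_of_nonneg_right hw (norm_nonneg _)
  set z := toComplex ξ + w • toComplex η with hz
  have hzt : z ∈ tube n K := fun j => by
    have him : (z j).im = w.im * η j := by simp [hz]
    rw [him, abs_mul]
    exact (mul_le_mul (Complex.abs_im_le_norm w) (PiLp.norm_apply_le η j) (abs_nonneg _)
      (norm_nonneg _)).trans (hwη.trans hK)
  have hξ : ‖ξ‖ ≤ ‖z‖ + b := by
    have h1 : toComplex ξ = z - w • toComplex η := by simp [hz]
    rw [← norm_toComplex, h1]
    refine (norm_sub_le _ _).trans ?_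
    rw [norm_smul, norm_toComplex]
    linarith
  -- Peetre's inequality compares the weight at `z` with the one at `ξ`.
  have hsq : 1 + ‖ξ‖ ^ 2 ≤ 2 * (1 + b ^ 2) * (1 + ‖z‖ ^ 2) := by
    have h1 : ‖ξ‖ ^ 2 ≤ (‖z‖ + b) ^ 2 := pow_le_pow_left₀ (norm_nonneg _) hξ 2
    nlinarith [sq_nonneg (‖z‖ - b), mul_nonneg (sq_nonneg b) (sq_nonneg ‖z‖)]
  refine (hC z hzt).trans ?_
  rw [mul_assoc]
  refine mul_le_mul_of_nonneg_left ?_ hC0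
  unfold decay
  rw [neg_div, Real.rpow_neg (by positivity), Real.rpow_neg (by positivity), ← div_eq_mul_inv,
    le_div_iff₀ (by positivity), inv_mul_le_iff₀ (by positivity), mul_comm (_ ^ _),
    ← Real.mul_rpow (by positivity) (by positivity)]
  exact Real.rpow_le_rpow (by positivity) hsq (by positivity)

/-- The integral of an entire function over `ℝⁿ + wη` does not depend on `w ∈ ℂ`, if the function
decays on the tubes: it is an entire function of `w`, which is constant on the real axis by
translation invariance of the Lebesgue measure. -/
lemma integral_toComplex_add_smul {F : EuclideanSpace ℂ (Fin n) → ℂ} (hF : Differentiable ℂ F)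
    (hb : ∀ K : ℕ, ∃ C, ∀ z ∈ tube n K, ‖F z‖ ≤ C * (1 + ‖z‖ ^ 2) ^ (-(n + 1 : ℝ) / 2))
    (η : EuclideanSpace ℝ (Fin n)) (w : ℂ) :
    ∫ ξ, F (toComplex ξ + w • toComplex η) = ∫ ξ, F (toComplex ξ) := by
  have hFc := hF.continuous
  set G : ℂ → ℂ := fun w => ∫ ξ, F (toComplex ξ + w • toComplex η) with hG
  have hdiff : ∀ ξ, Differentiable ℂ fun w : ℂ => F (toComplex ξ + w • toComplex η) :=
    fun ξ => hF.comp (by fun_prop)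
  have hGd : Differentiable ℂ G := by
    intro w₀
    -- The radius `‖w₀‖ + 2` contains the unit circles around the points of the unit ball at `w₀`,
    -- on which Cauchy's estimate for the derivative in `w` is applied.
    obtain ⟨C, hC⟩ := exists_norm_translate_le hb η (‖w₀‖ + 2)
    have hmeas : ∀ w : ℂ, AEStronglyMeasurable
        (fun ξ : EuclideanSpace ℝ (Fin n) => F (toComplex ξ + w • toComplex η)) volume :=
      fun w => (by fun_prop : Continuous _).aestronglyMeasurable
    refine (hasDerivAt_integral_of_dominated_loc_of_deriv_le (μ := volume)
      (F := fun w ξ => F (toComplex ξ + w • toComplex η))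
      (F' := fun w ξ => deriv (fun w : ℂ => F (toComplex ξ + w • toComplex η)) w)
      (bound := fun ξ => C * decay n ξ)
      (Metric.ball_mem_nhds w₀ one_pos) (Eventually.of_forall hmeas) ?_ ?_ ?_
      (integrable_decay.const_mul C) ?_).2.differentiableAt
    · refine (integrable_decay.const_mul C).mono' (hmeas w₀) (Eventually.of_forall fun ξ => ?_)
      exact hC w₀ ξ (by linarith)
    · have hc : Continuous (Function.uncurry fun (ξ : EuclideanSpace ℝ (Fin n)) (w : ℂ) =>
          F (toComplex ξ + w • toComplex η)) := by
        unfold Function.uncurry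
        fun_prop
      exact ((measurable_deriv_with_param hc).comp
        (measurable_id.prodMk measurable_const)).aestronglyMeasurable
    · refine Eventually.of_forall fun ξ w hw => ?_
      have := Complex.norm_deriv_le_of_forall_mem_sphere_norm_le (c := w) one_pos
        (hdiff ξ).diffContOnCl (C := C * decay n ξ) fun v hv => hC v ξ ?_
      · simpa using this
      · have h1 := mem_sphere_iff_norm.1 hv
        have h2 := mem_ball_iff_norm.1 hw
        have h3 : v = (v - w) + (w - w₀) + w₀ := by ring
        rw [h3]
        refine (norm_add₃_le).trans ?_
        linarith
    · exact Eventually.of_forall fun ξ w _ => (hdiff ξ w).hasDerivAt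
  have hreal : ∀ s : ℝ, G s = ∫ ξ, F (toComplex ξ) := fun s => by
    simp only [hG, ← toComplex_smul, ← toComplex_add]
    exact integral_add_right_eq_self (fun ξ => F (toComplex ξ)) (s • η)
  have hfreq : ∃ᶠ w in 𝓝[≠] (0 : ℂ), G w = ∫ ξ, F (toComplex ξ) := by
    have ht : Tendsto (fun s : ℝ => (s : ℂ)) (𝓝[≠] 0) (𝓝[≠] 0) := by
      refine tendsto_nhdsWithin_iff.2 ⟨?_, ?_⟩
      · exact (Complex.continuous_ofReal.tendsto' 0 0 (by simp)).mono_left nhdsWithin_le_nhds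
      · filter_upwards [self_mem_nhdsWithin] with s hs
        simpa using hs
    exact ht.frequently (Eventually.of_forall hreal).frequently
  have := AnalyticOnNhd.eq_of_frequently_eq (f := G) (g := fun _ => ∫ ξ, F (toComplex ξ))
    (z₀ := 0) (fun z _ => hGd.analyticAt z) (fun z _ => analyticAt_const) hfreq
  exact congrFun this w

end Shift

/-! ### The inverse Fourier transform on `𝒰(ℂⁿ)` -/

section Fourier

variable {n : ℕ}

lemma U.differentiable (ψ : U n) : Differentiable ℂ ψ := ψ.2.1

lemma U.continuous (ψ : U n) : Continuous ψ := ψ.differentiable.continuous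

lemma norm_le_theta_mul_rpow (ψ : U n) {k l : ℕ} (hkl : k ≤ l) {z : EuclideanSpace ℂ (Fin n)}
    (hz : z ∈ tube n l) : ‖ψ z‖ ≤ theta n l ψ * (1 + ‖z‖ ^ 2) ^ (-(k : ℝ) / 2) := by
  rw [neg_div, Real.rpow_neg (by positivity), ← div_eq_mul_inv, le_div_iff₀ (by positivity),
    mul_comm]
  exact weight_mul_norm_le_theta_of_le ψ hkl hz

lemma norm_toComplex_le_theta_mul_decay (ψ : U n) {l : ℕ} (hl : n + 1 ≤ l)
    (ξ : EuclideanSpace ℝ (Fin n)) : ‖ψ (toComplex ξ)‖ ≤ theta n l ψ * decay n ξ := by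
  simpa [decay] using norm_le_theta_mul_rpow ψ hl (toComplex_mem_tube ξ l)

/-- The inverse Fourier transform of the restriction of `ψ` to `ℝⁿ`. -/
def invFourier (ψ : EuclideanSpace ℂ (Fin n) → ℂ) (t : EuclideanSpace ℝ (Fin n)) : ℂ :=
  ∫ ξ, Complex.exp (2 * Real.pi * Complex.I * (inner ℝ ξ t : ℝ)) * ψ (toComplex ξ)

variable (n) in
/-- The integral of the weight `(1+|ξ|²)^{-(n+1)/2}`. -/
def decayIntegral : ℝ := ∫ ξ, decay n ξ

lemma decayIntegral_nonneg : 0 ≤ decayIntegral n := integral_nonneg fun ξ => (decay_pos ξ).le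

/-- Exponential decay of the inverse Fourier transform: the domain of integration is moved to
`ℝⁿ + iη` with `η_j = k sign(t_j)`, where the exponential has absolute value
`e^{-2πη·t} ≤ e^{-k|t|}`. -/
lemma exp_mul_norm_invFourier_le (ψ : U n) (k : ℕ) (t : EuclideanSpace ℝ (Fin n)) :
    Real.exp (k * ‖t‖) * ‖invFourier ψ t‖ ≤ decayIntegral n * theta n (k + n + 1) ψ := by
  set F : EuclideanSpace ℂ (Fin n) → ℂ := fun z =>
    Complex.exp (2 * Real.pi * Complex.I * inner ℂ (toComplex t) z) * ψ z with hFdef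
  have hFd : Differentiable ℂ F := by
    have h1 : Differentiable ℂ fun z : EuclideanSpace ℂ (Fin n) => inner ℂ (toComplex t) z :=
      (innerSL ℂ (toComplex t)).differentiable
    exact ((h1.const_mul _).cexp).mul ψ.differentiable
  have hb : ∀ K : ℕ, ∃ C, ∀ z ∈ tube n K,
      ‖F z‖ ≤ C * (1 + ‖z‖ ^ 2) ^ (-(n + 1 : ℝ) / 2) := by
    intro K
    refine ⟨Real.exp (2 * Real.pi * ((∑ j, |t j|) * K)) * theta n (K + n + 1) ψ,
      fun z hz => ?_⟩
    rw [hFdef, norm_mul, norm_cexp_two_pi_I_mul]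
    have h1 := norm_le_theta_mul_rpow ψ (show n + 1 ≤ K + n + 1 by omega)
      (tube_mono (show K ≤ K + n + 1 by omega) hz)
    push_cast at h1
    refine (mul_le_mul (Real.exp_le_exp.2 ?_) h1 (norm_nonneg _) (Real.exp_pos _).le).trans_eq
      (mul_assoc _ _ _).symm
    rw [← mul_neg]
    exact mul_le_mul_of_nonneg_left ((neg_le_abs _).trans (abs_im_inner_toComplex_le t hz))
      (by positivity)
  set η : EuclideanSpace ℝ (Fin n) :=
    WithLp.toLp 2 fun j => (k : ℝ) * (if 0 ≤ t j then 1 else -1) with hη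
  have hηt : k * ‖t‖ ≤ inner ℝ t η := by
    have h1 : inner ℝ t η = k * ∑ j, |t j| := by
      rw [PiLp.inner_apply, Finset.mul_sum]
      refine Finset.sum_congr rfl fun j _ => ?_
      simp only [hη, RCLike.inner_apply, conj_trivial]
      split_ifs with h
      · rw [abs_of_nonneg h]; ring
      · rw [abs_of_neg (not_le.1 h)]; ring
    rw [h1]
    exact mul_le_mul_of_nonneg_left (norm_le_sum_abs t) (Nat.cast_nonneg k)
  have hshift : invFourier ψ t = ∫ ξ, F (toComplex ξ + Complex.I • toComplex η) := by
    rw [integral_toComplex_add_smul hFd hb]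
    simp only [invFourier, hFdef, inner_toComplex_toComplex, real_inner_comm]
  have hnorm : ‖invFourier ψ t‖ ≤ Real.exp (-(k * ‖t‖)) *
      (decayIntegral n * theta n (k + n + 1) ψ) := by
    rw [hshift, decayIntegral, ← integral_mul_const, ← integral_const_mul]
    refine norm_integral_le_of_norm_le
      ((integrable_decay.mul_const _).const_mul _) (Eventually.of_forall fun ξ => ?_)
    have hz : toComplex ξ + Complex.I • toComplex η ∈ tube n (k + n + 1) := fun j => by
      have : ((toComplex ξ + Complex.I • toComplex η) j).im = η j := by simp
      rw [this]
      have h2 : |η j| = k := by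
        simp only [hη]
        split_ifs <;> simp
      rw [h2]
      push_cast
      linarith [Nat.cast_nonneg (α := ℝ) n]
    rw [hFdef, norm_mul, norm_cexp_two_pi_I_mul]
    refine mul_le_mul (Real.exp_le_exp.2 ?_) ?_ (norm_nonneg _) (Real.exp_pos _).le
    · have h3 : (inner ℂ (toComplex t) (toComplex ξ + Complex.I • toComplex η)).im
          = inner ℝ t η := by
        rw [inner_add_right, inner_smul_right, inner_toComplex_toComplex,
          inner_toComplex_toComplex]
        simp
      rw [h3, neg_le_neg_iff]
      have h4 : 0 ≤ inner ℝ t η := le_trans (by positivity) hηt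
      nlinarith [Real.pi_gt_three]
    · have h1 := norm_le_theta_mul_rpow ψ (show n + 1 ≤ k + n + 1 by omega) hz
      rw [mul_comm]
      refine h1.trans (mul_le_mul_of_nonneg_left ?_ (apply_nonneg _ _))
      push_cast
      refine Real.rpow_le_rpow_of_nonpos (by positivity) ?_ ?_
      · gcongr
        exact norm_le_norm_toComplex_add_I_smul ξ η
      · rw [neg_div]
        exact neg_nonpos.2 (by positivity)
  calc _ ≤ Real.exp (k * ‖t‖) * _ := mul_le_mul_of_nonneg_left hnorm (Real.exp_pos _).le
    _ = _ := by rw [← mul_assoc, ← Real.exp_add, add_neg_cancel, Real.exp_zero, one_mul]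

lemma norm_prod_inner_le {m : ℕ} (v : Fin m → EuclideanSpace ℝ (Fin n))
    (z : EuclideanSpace ℂ (Fin n)) :
    ‖∏ i, inner ℂ (toComplex (v i)) z‖ ≤ (∏ i, ‖v i‖) * ‖z‖ ^ m := by
  rw [norm_prod]
  calc ∏ i, ‖inner ℂ (toComplex (v i)) z‖ ≤ ∏ i, ‖v i‖ * ‖z‖ :=
        Finset.prod_le_prod (fun _ _ => norm_nonneg _) fun i _ => by
          simpa using norm_inner_le_norm (𝕜 := ℂ) (toComplex (v i)) z
    _ = _ := by simp [Finset.prod_mul_distrib]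

lemma weight_mul_norm_prod_mul_le (ψ : U n) {m : ℕ} (v : Fin m → EuclideanSpace ℝ (Fin n))
    (k : ℕ) {z : EuclideanSpace ℂ (Fin n)} (hz : z ∈ tube n k) :
    (1 + ‖z‖ ^ 2) ^ ((k : ℝ) / 2) * ‖(∏ i, inner ℂ (toComplex (v i)) z) * ψ z‖
      ≤ (∏ i, ‖v i‖) * theta n (k + m) ψ := by
  have hpow : ‖z‖ ^ m ≤ (1 + ‖z‖ ^ 2) ^ ((m : ℝ) / 2) := by
    rw [Real.rpow_div_two_eq_sqrt _ (by positivity), Real.rpow_natCast]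
    exact pow_le_pow_left₀ (norm_nonneg _) (Real.le_sqrt_of_sq_le (by linarith)) m
  rw [norm_mul]
  calc (1 + ‖z‖ ^ 2) ^ ((k : ℝ) / 2) * (‖∏ i, inner ℂ (toComplex (v i)) z‖ * ‖ψ z‖)
      ≤ (1 + ‖z‖ ^ 2) ^ ((k : ℝ) / 2) *
          ((∏ i, ‖v i‖) * (1 + ‖z‖ ^ 2) ^ ((m : ℝ) / 2) * ‖ψ z‖) := by
        gcongr
        refine (norm_prod_inner_le v z).trans ?_
        gcongr
    _ = (∏ i, ‖v i‖) * ((1 + ‖z‖ ^ 2) ^ (((k + m : ℕ) : ℝ) / 2) * ‖ψ z‖) := by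
        push_cast
        rw [add_div, Real.rpow_add (by positivity)]
        ring
    _ ≤ _ := by
        gcongr
        exact weight_mul_norm_le_theta ψ (tube_mono (Nat.le_add_right k m) hz)

/-- Multiplication of `ψ ∈ 𝒰(ℂⁿ)` by the polynomial `z ↦ ∏ᵢ z·vᵢ`. -/
def U.mulProd {m : ℕ} (v : Fin m → EuclideanSpace ℝ (Fin n)) (ψ : U n) : U n :=
  ⟨fun z => (∏ i, inner ℂ (toComplex (v i)) z) * ψ z, by
    refine ⟨Differentiable.mul ?_ ψ.differentiable, fun k => ⟨(∏ i, ‖v i‖) * theta n (k + m) ψ, ?_⟩⟩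
    · have h (i : Fin m) : Differentiable ℂ fun z : EuclideanSpace ℂ (Fin n) =>
          inner ℂ (toComplex (v i)) z := (innerSL ℂ (toComplex (v i))).differentiable
      fun_prop
    · rintro _ ⟨z, rfl⟩
      exact weight_mul_norm_prod_mul_le ψ v k z.2⟩

lemma theta_mulProd_le {m : ℕ} (v : Fin m → EuclideanSpace ℝ (Fin n)) (ψ : U n) (k : ℕ) :
    theta n k (U.mulProd v ψ) ≤ (∏ i, ‖v i‖) * theta n (k + m) ψ :=
  theta_le fun _ hz => weight_mul_norm_prod_mul_le ψ v k hz

lemma U.integrable_toComplex (ψ : U n) : Integrable fun ξ => ψ (toComplex ξ) :=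
  (integrable_decay.const_mul (theta n (n + 1) ψ)).mono'
    (ψ.continuous.comp continuous_toComplex).aestronglyMeasurable
    (Eventually.of_forall fun ξ => norm_toComplex_le_theta_mul_decay ψ le_rfl ξ)

lemma integrable_pow_mul_norm (ψ : U n) (m : ℕ) :
    Integrable fun ξ : EuclideanSpace ℝ (Fin n) => ‖ξ‖ ^ m * ‖ψ (toComplex ξ)‖ := by
  refine (integrable_decay.const_mul (theta n (n + 1 + m) ψ)).mono' ?_
    (Eventually.of_forall fun ξ => ?_)
  · have := ψ.continuous
    exact (by fun_prop : Continuous _).aestronglyMeasurable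
  · have h := norm_le_theta_mul_rpow ψ (le_refl (n + 1 + m)) (toComplex_mem_tube ξ _)
    rw [norm_toComplex] at h
    rw [Real.norm_of_nonneg (by positivity)]
    calc ‖ξ‖ ^ m * ‖ψ (toComplex ξ)‖ ≤ (1 + ‖ξ‖ ^ 2) ^ ((m : ℝ) / 2) *
          (theta n (n + 1 + m) ψ * (1 + ‖ξ‖ ^ 2) ^ (-((n + 1 + m : ℕ) : ℝ) / 2)) := by
          gcongr
          rw [Real.rpow_div_two_eq_sqrt _ (by positivity), Real.rpow_natCast]
          exact pow_le_pow_left₀ (norm_nonneg _) (Real.le_sqrt_of_sq_le (by linarith)) m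
      _ = _ := by
          rw [mul_left_comm, ← Real.rpow_add (by positivity), decay]
          congr 2
          push_cast
          ring

/-- The inverse Fourier transform as a Fourier integral for the bilinear form `-ξ·t`. -/
lemma invFourier_eq_fourierIntegral (ψ : EuclideanSpace ℂ (Fin n) → ℂ) :
    invFourier ψ = VectorFourier.fourierIntegral Real.fourierChar volume
      (-innerSL ℝ : EuclideanSpace ℝ (Fin n) →L[ℝ] EuclideanSpace ℝ (Fin n) →L[ℝ] ℝ).toLinearMap₁₂
      fun ξ => ψ (toComplex ξ) := by
  ext t
  refine integral_congr_ae (Eventually.of_forall fun ξ => ?_)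
  simp [Circle.smul_def, Real.fourierChar_apply]
  left
  ring_nf

lemma contDiff_invFourier (ψ : U n) : ContDiff ℝ ∞ (invFourier ψ) := by
  rw [invFourier_eq_fourierIntegral]
  exact VectorFourier.contDiff_fourierIntegral _ fun m _ => integrable_pow_mul_norm ψ m

lemma iteratedFDeriv_invFourier_apply (ψ : U n) {m : ℕ} (t : EuclideanSpace ℝ (Fin n))
    (v : Fin m → EuclideanSpace ℝ (Fin n)) :
    iteratedFDeriv ℝ m (invFourier ψ) t v
      = (2 * Real.pi * Complex.I) ^ m * invFourier (U.mulProd v ψ) t := by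
  have hm : AEStronglyMeasurable (fun ξ => ψ (toComplex ξ)) volume :=
    ψ.integrable_toComplex.aestronglyMeasurable
  rw [invFourier_eq_fourierIntegral, VectorFourier.iteratedFDeriv_fourierIntegral (N := ⊤) _
    (fun m _ => integrable_pow_mul_norm ψ m) hm le_top,
    Real.fourierIntegral_continuousMultilinearMap_apply'
      (VectorFourier.integrable_fourierPowSMulRight _ (integrable_pow_mul_norm ψ m) hm),
    invFourier_eq_fourierIntegral]
  rw [VectorFourier.fourierIntegral, VectorFourier.fourierIntegral, ← integral_const_mul]
  refine integral_congr_ae (Eventually.of_forall fun ξ => ?_)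
  simp only [VectorFourier.fourierPowSMulRight_apply, U.mulProd, inner_toComplex_toComplex,
    neg_apply, Circle.smul_def, Complex.real_smul,
    smul_eq_mul, real_inner_comm, Finset.prod_neg, neg_pow (2 * Real.pi * Complex.I)]
  have hinner : ∀ i, innerSL ℝ ξ (v i) = inner ℝ ξ (v i) := fun _ => rfl
  push_cast
  simp only [hinner, Finset.card_univ, Fintype.card_fin]
  have : ((-1 : ℂ) ^ m) * (-1) ^ m = 1 := by rw [← mul_pow]; simp
  linear_combination (Real.fourierChar _ : ℂ) * (2 * Real.pi * Complex.I) ^ m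
    * (∏ i, ((inner ℝ ξ (v i) : ℝ) : ℂ)) * ψ (toComplex ξ) * this

lemma exp_mul_norm_iteratedFDeriv_invFourier_le (ψ : U n) {k m : ℕ} (hm : m ≤ k)
    (t : EuclideanSpace ℝ (Fin n)) :
    Real.exp (k * ‖t‖) * ‖iteratedFDeriv ℝ m (invFourier ψ) t‖
      ≤ (2 * Real.pi) ^ k * decayIntegral n * theta n (k + n + 1 + k) ψ := by
  have hpi : (1 : ℝ) ≤ 2 * Real.pi := by linarith [Real.pi_gt_three]
  have h : ‖iteratedFDeriv ℝ m (invFourier ψ) t‖ ≤ Real.exp (-(k * ‖t‖)) *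
      ((2 * Real.pi) ^ k * decayIntegral n * theta n (k + n + 1 + k) ψ) := by
    have h0 := decayIntegral_nonneg (n := n)
    refine ContinuousMultilinearMap.opNorm_le_bound (by positivity) fun v => ?_
    rw [iteratedFDeriv_invFourier_apply, norm_mul, norm_pow]
    have h1 : ‖invFourier (U.mulProd v ψ) t‖ ≤ Real.exp (-(k * ‖t‖)) *
        (decayIntegral n * ((∏ i, ‖v i‖) * theta n (k + n + 1 + k) ψ)) := by
      rw [Real.exp_neg, ← div_eq_inv_mul, le_div_iff₀ (Real.exp_pos _), mul_comm]
      refine (exp_mul_norm_invFourier_le (U.mulProd v ψ) k t).trans ?_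
      gcongr
      refine (theta_mulProd_le v ψ _).trans ?_
      gcongr
      exact theta_mono (by omega) ψ
    have h2 : ‖2 * (Real.pi : ℂ) * Complex.I‖ = 2 * Real.pi := by
      simp [abs_of_pos Real.pi_pos]
    rw [h2]
    calc _ ≤ (2 * Real.pi) ^ k * (Real.exp (-(k * ‖t‖)) *
        (decayIntegral n * ((∏ i, ‖v i‖) * theta n (k + n + 1 + k) ψ))) := by
          gcongr
      _ = _ := by ring
  calc _ ≤ Real.exp (k * ‖t‖) * _ := mul_le_mul_of_nonneg_left h (Real.exp_pos _).le
    _ = _ := by rw [← mul_assoc, ← Real.exp_add, add_neg_cancel, Real.exp_zero, one_mul]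

end Fourier

/-! ### Convolution on `𝒦₁(ℝ)` -/

section Convolution

/-- The exponential decay of `φ` is only used through the weaker weight `(1+x²)⁻¹`, whose integral
is `π`. -/
lemma norm_le_rho_mul_inv (φ : K1 ℝ) (x : ℝ) : ‖φ x‖ ≤ 2 * rho ℝ 1 φ * (1 + x ^ 2)⁻¹ := by
  have h1 := exp_mul_norm_le_rho φ 1 x
  have h2 := Real.quadratic_le_exp_of_nonneg (abs_nonneg x)
  rw [sq_abs] at h2
  rw [← div_eq_mul_inv, le_div_iff₀ (by positivity)]
  rw [Nat.cast_one, one_mul, Real.norm_eq_abs] at h1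
  nlinarith [norm_nonneg (φ x), abs_nonneg x]

lemma integrable_mul_comp_sub (φ : K1 ℝ) {f : ℝ → ℂ} (hf : Continuous f) {B : ℝ}
    (hB : ∀ y, ‖f y‖ ≤ B) (s : ℝ) : Integrable fun x => φ x * f (s - x) := by
  have := φ.continuous
  refine (integrable_inv_one_add_sq.const_mul (2 * rho ℝ 1 φ * B)).mono'
    (by fun_prop : Continuous _).aestronglyMeasurable (Eventually.of_forall fun x => ?_)
  rw [norm_mul, mul_right_comm]
  exact mul_le_mul (norm_le_rho_mul_inv φ x) (hB _) (norm_nonneg _)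
    (by have := apply_nonneg (rho ℝ 1) φ; positivity)

lemma K1.norm_iteratedDeriv_le_rho (g : K1 ℝ) (m : ℕ) (y : ℝ) :
    ‖iteratedDeriv m g y‖ ≤ rho ℝ m g := by
  rw [← norm_iteratedFDeriv_eq_norm_iteratedDeriv]
  exact norm_iteratedFDeriv_le_rho g le_rfl y

lemma K1.continuous_iteratedDeriv (g : K1 ℝ) (m : ℕ) : Continuous (iteratedDeriv m g) :=
  g.contDiff.continuous_iteratedDeriv m (by exact_mod_cast le_top)

lemma K1.hasDerivAt_iteratedDeriv (g : K1 ℝ) (m : ℕ) (y : ℝ) :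
    HasDerivAt (iteratedDeriv m g) (iteratedDeriv (m + 1) g y) y := by
  rw [iteratedDeriv_succ]
  exact (g.contDiff.differentiable_iteratedDeriv m
    (by exact_mod_cast WithTop.coe_lt_top (m : ℕ)) y).hasDerivAt

/-- The convolution `φ * f`. -/
def conv (φ : K1 ℝ) (f : ℝ → ℂ) (s : ℝ) : ℂ := ∫ x, φ x * f (s - x)

lemma hasDerivAt_conv_iteratedDeriv (φ g : K1 ℝ) (m : ℕ) (s : ℝ) :
    HasDerivAt (conv φ (iteratedDeriv m g)) (conv φ (iteratedDeriv (m + 1) g) s) s := by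
  have hint := fun m s => integrable_mul_comp_sub φ (g.continuous_iteratedDeriv m)
    (g.norm_iteratedDeriv_le_rho m) s
  refine (hasDerivAt_integral_of_dominated_loc_of_deriv_le (μ := volume)
    (F := fun s x => φ x * iteratedDeriv m g (s - x))
    (F' := fun s x => φ x * iteratedDeriv (m + 1) g (s - x))
    (bound := fun x => 2 * rho ℝ 1 φ * (1 + x ^ 2)⁻¹ * rho ℝ (m + 1) g)
    univ_mem (Eventually.of_forall fun s => (hint m s).aestronglyMeasurable) (hint m s)
    (hint (m + 1) s).aestronglyMeasurable ?_
    ((integrable_inv_one_add_sq.const_mul _).mul_const _) ?_).2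
  · refine Eventually.of_forall fun x s _ => ?_
    rw [norm_mul]
    exact mul_le_mul (norm_le_rho_mul_inv φ x) (g.norm_iteratedDeriv_le_rho _ _) (norm_nonneg _)
      (by have := apply_nonneg (rho ℝ 1) φ; positivity)
  · exact Eventually.of_forall fun x s _ =>
      ((g.hasDerivAt_iteratedDeriv m (s - x)).comp_sub_const s x).const_mul (φ x)

lemma iteratedDeriv_conv (φ g : K1 ℝ) (m : ℕ) :
    iteratedDeriv m (conv φ g) = conv φ (iteratedDeriv m g) := by
  induction m with
  | zero => simp
  | succ m ih =>
    rw [iteratedDeriv_succ, ih]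
    exact funext fun s => (hasDerivAt_conv_iteratedDeriv φ g m s).deriv

lemma contDiff_conv (φ g : K1 ℝ) : ContDiff ℝ ∞ (conv φ g) :=
  contDiff_of_differentiable_iteratedDeriv fun m _ => by
    rw [iteratedDeriv_conv]
    exact fun s => (hasDerivAt_conv_iteratedDeriv φ g m s).differentiableAt

lemma norm_iteratedFDeriv_conv_le (φ g : K1 ℝ) (m : ℕ) (s : ℝ) :
    ‖iteratedFDeriv ℝ m (conv φ g) s‖ ≤ 2 * Real.pi * rho ℝ 1 φ * rho ℝ m g := by
  rw [norm_iteratedFDeriv_eq_norm_iteratedDeriv, iteratedDeriv_conv]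
  have h : ‖conv φ (iteratedDeriv m g) s‖
      ≤ ∫ x : ℝ, 2 * rho ℝ 1 φ * rho ℝ m g * (1 + x ^ 2)⁻¹ := by
    refine norm_integral_le_of_norm_le (integrable_inv_one_add_sq.const_mul _)
      (Eventually.of_forall fun x => ?_)
    rw [norm_mul, mul_right_comm]
    exact mul_le_mul (norm_le_rho_mul_inv φ x) (g.norm_iteratedDeriv_le_rho _ _) (norm_nonneg _)
      (by have := apply_nonneg (rho ℝ 1) φ; positivity)
  rw [integral_const_mul, integral_univ_inv_one_add_sq] at h
  linarith

end Convolution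

/-! ### The synthesis operator on the algebraic tensor product -/

section Algebraic

variable {n : ℕ}

lemma norm_iteratedFDeriv_conv_inner_le (u : EuclideanSpace ℝ (Fin n)) (φ g : K1 ℝ) {k m : ℕ}
    (hm : m ≤ k) (t : EuclideanSpace ℝ (Fin n)) :
    ‖iteratedFDeriv ℝ m (fun t => conv φ g (inner ℝ u t)) t‖
      ≤ 2 * Real.pi * rho ℝ 1 φ * rho ℝ k g * (1 + ‖u‖) ^ k := by
  have h := (innerSL ℝ u).iteratedFDeriv_comp_right (contDiff_conv φ g) t
    (i := m) (by exact_mod_cast le_top)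
  have h' : (fun t => conv φ g (inner ℝ u t)) = conv φ g ∘ innerSL ℝ u := rfl
  have hφ := apply_nonneg (rho ℝ 1) φ
  have hg := apply_nonneg (rho ℝ k) g
  rw [h', h]
  refine (ContinuousMultilinearMap.norm_compContinuousLinearMap_le _ _).trans ?_
  rw [Finset.prod_const, Finset.card_univ, Fintype.card_fin, innerSL_apply_norm]
  refine mul_le_mul ((norm_iteratedFDeriv_conv_le φ g m _).trans ?_) ?_ (by positivity)
    (by positivity)
  · gcongr
    exact rho_mono hm g
  · exact (pow_le_pow_left₀ (norm_nonneg _) (by linarith) m).trans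
      (pow_le_pow_right₀ (by linarith [norm_nonneg u]) hm)

/-- The constant in the estimate for `ρ_k` of the synthesis operator. -/
def synthesisConst (u : EuclideanSpace ℝ (Fin n)) (k : ℕ) : ℝ :=
  2 ^ k * (2 * Real.pi * (1 + ‖u‖) ^ k * ((2 * Real.pi) ^ k * decayIntegral n))

lemma synthesisConst_nonneg (u : EuclideanSpace ℝ (Fin n)) (k : ℕ) : 0 ≤ synthesisConst u k := by
  have := decayIntegral_nonneg (n := n)
  unfold synthesisConst
  positivity

lemma exp_mul_norm_iteratedFDeriv_conv_mul_invFourier_le (u : EuclideanSpace ℝ (Fin n))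
    (φ g : K1 ℝ) (ψ : U n) (k m : ℕ) (hm : m ≤ k) (t : EuclideanSpace ℝ (Fin n)) :
    Real.exp (k * ‖t‖) *
        ‖iteratedFDeriv ℝ m (fun t => conv φ g (inner ℝ u t) * invFourier ψ t) t‖
      ≤ synthesisConst u k * rho ℝ k g * (rho ℝ 1 φ * theta n (k + n + 1 + k) ψ) := by
  set A := 2 * Real.pi * rho ℝ 1 φ * rho ℝ k g * (1 + ‖u‖) ^ k with hA
  set B := (2 * Real.pi) ^ k * decayIntegral n * theta n (k + n + 1 + k) ψ with hB
  have hA0 : 0 ≤ A := (norm_nonneg _).trans (norm_iteratedFDeriv_conv_inner_le u φ g hm t)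
  have hB0 : 0 ≤ B := le_trans (by positivity) (exp_mul_norm_iteratedFDeriv_invFourier_le ψ hm t)
  have hc : ContDiff ℝ ∞ fun t => conv φ g (inner ℝ u t) :=
    (contDiff_conv φ g).comp (innerSL ℝ u).contDiff
  have h := norm_iteratedFDeriv_mul_le hc (contDiff_invFourier ψ) t (n := m)
    (by exact_mod_cast le_top)
  refine (mul_le_mul_of_nonneg_left h (Real.exp_pos _).le).trans ?_
  rw [Finset.mul_sum]
  calc _ ≤ ∑ i ∈ Finset.range (m + 1), (m.choose i : ℝ) * (A * B) := by
        refine Finset.sum_le_sum fun i hi => ?_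
        have h1 := norm_iteratedFDeriv_conv_inner_le u φ g
          ((Nat.lt_succ_iff.1 (Finset.mem_range.1 hi)).trans hm) t
        have h2 := exp_mul_norm_iteratedFDeriv_invFourier_le ψ ((Nat.sub_le m i).trans hm) t
        calc _ = (m.choose i : ℝ) * (‖iteratedFDeriv ℝ i (fun t => conv φ g (inner ℝ u t)) t‖ *
              (Real.exp (k * ‖t‖) * ‖iteratedFDeriv ℝ (m - i) (invFourier ψ) t‖)) := by ring
          _ ≤ _ := by gcongr
    _ = 2 ^ m * (A * B) := by
        rw [← Finset.sum_mul, ← Nat.cast_sum, Nat.sum_range_choose]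
        push_cast
        rfl
    _ ≤ 2 ^ k * (A * B) := by
        gcongr
        norm_num
    _ = _ := by
        rw [hA, hB, synthesisConst]
        ring

/-- The synthesis operator on simple tensors: `t ↦ (φ * g)(u·t) ψ̌(t)`. -/
def synthesisSimple (u : EuclideanSpace ℝ (Fin n)) (φ : K1 ℝ) (ψ : U n) (g : K1 ℝ) :
    K1 (EuclideanSpace ℝ (Fin n)) :=
  K1.ofBound (fun t => conv φ g (inner ℝ u t) * invFourier ψ t)
    (((contDiff_conv φ g).comp (innerSL ℝ u).contDiff).mul (contDiff_invFourier ψ)) _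
    (exp_mul_norm_iteratedFDeriv_conv_mul_invFourier_le u φ g ψ)

lemma synthesisSimple_apply (u : EuclideanSpace ℝ (Fin n)) (φ : K1 ℝ) (ψ : U n) (g : K1 ℝ)
    (t : EuclideanSpace ℝ (Fin n)) :
    synthesisSimple u φ ψ g t = conv φ g (inner ℝ u t) * invFourier ψ t := rfl

lemma rho_synthesisSimple_le (u : EuclideanSpace ℝ (Fin n)) (φ : K1 ℝ) (ψ : U n) (g : K1 ℝ)
    (k : ℕ) : rho _ k (synthesisSimple u φ ψ g)
      ≤ synthesisConst u k * rho ℝ k g * (rho ℝ 1 φ * theta n (k + n + 1 + k) ψ) :=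
  rho_le (exp_mul_norm_iteratedFDeriv_conv_mul_invFourier_le u φ g ψ k)

lemma K1.integrable_mul_comp_sub (φ g : K1 ℝ) (s : ℝ) : Integrable fun x => φ x * g (s - x) :=
  DSTFT.integrable_mul_comp_sub φ g.continuous (fun y => by
    simpa using g.norm_iteratedDeriv_le_rho 0 y) s

lemma conv_add_left (φ φ' g : K1 ℝ) (s : ℝ) : conv (φ + φ') g s = conv φ g s + conv φ' g s := by
  unfold conv
  rw [← integral_add (φ.integrable_mul_comp_sub g s) (φ'.integrable_mul_comp_sub g s)]
  exact integral_congr_ae (Eventually.of_forall fun x => add_mul _ _ _)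

lemma conv_add_right (φ g g' : K1 ℝ) (s : ℝ) :
    conv φ (g + g' : K1 ℝ) s = conv φ g s + conv φ g' s := by
  unfold conv
  rw [← integral_add (φ.integrable_mul_comp_sub g s) (φ.integrable_mul_comp_sub g' s)]
  exact integral_congr_ae (Eventually.of_forall fun x => mul_add _ _ _)

lemma conv_smul_left (c : ℂ) (φ g : K1 ℝ) (s : ℝ) : conv (c • φ) g s = c * conv φ g s := by
  unfold conv
  rw [← integral_const_mul]
  exact integral_congr_ae (Eventually.of_forall fun x => mul_assoc _ _ _)

lemma conv_smul_right (c : ℂ) (φ g : K1 ℝ) (s : ℝ) :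
    conv φ (c • g : K1 ℝ) s = c * conv φ g s := by
  unfold conv
  rw [← integral_const_mul]
  exact integral_congr_ae (Eventually.of_forall fun x => mul_left_comm _ _ _)

lemma norm_cexp_two_pi_I_mul_ofReal (a : ℝ) :
    ‖Complex.exp (2 * Real.pi * Complex.I * (a : ℂ))‖ = 1 := by
  simp [norm_cexp_two_pi_I_mul]

lemma U.integrable_cexp_mul (ψ : U n) (t : EuclideanSpace ℝ (Fin n)) :
    Integrable fun ξ => Complex.exp (2 * Real.pi * Complex.I * (inner ℝ ξ t : ℝ)) *
      ψ (toComplex ξ) := by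
  refine ψ.integrable_toComplex.norm.mono' ?_ (Eventually.of_forall fun ξ => ?_)
  · have := ψ.continuous
    exact (by fun_prop : Continuous _).aestronglyMeasurable
  · rw [norm_mul, norm_cexp_two_pi_I_mul_ofReal, one_mul]

lemma invFourier_add (ψ ψ' : U n) (t : EuclideanSpace ℝ (Fin n)) :
    invFourier (ψ + ψ' : U n) t = invFourier ψ t + invFourier ψ' t := by
  unfold invFourier
  rw [← integral_add (ψ.integrable_cexp_mul t) (ψ'.integrable_cexp_mul t)]
  exact integral_congr_ae (Eventually.of_forall fun x => mul_add _ _ _)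

lemma invFourier_smul (c : ℂ) (ψ : U n) (t : EuclideanSpace ℝ (Fin n)) :
    invFourier (c • ψ : U n) t = c * invFourier ψ t := by
  unfold invFourier
  rw [← integral_const_mul]
  exact integral_congr_ae (Eventually.of_forall fun x => mul_left_comm _ _ _)

/-- The synthesis operator on the algebraic tensor product, the linear extension of
`φ ⊗ ψ ↦ (g ↦ (φ * g)(u·t) ψ̌(t))`. -/
def synthesisAlg (u : EuclideanSpace ℝ (Fin n)) :
    K1TensorU n →ₗ[ℂ] K1 ℝ →ₗ[ℂ] K1 (EuclideanSpace ℝ (Fin n)) :=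
  (TensorProduct.lift (LinearMap.mk₂ ℂ
    (fun (φ : K1 ℝ) (ψ : U n) =>
      ({ toFun := synthesisSimple u φ ψ
         map_add' := fun g g' => K1.ext fun _ =>
          (congrArg (· * _) (conv_add_right φ g g' _)).trans (add_mul _ _ _)
         map_smul' := fun c g => K1.ext fun _ =>
          (congrArg (· * _) (conv_smul_right c φ g _)).trans (mul_assoc _ _ _) } :
        K1 ℝ →ₗ[ℂ] K1 (EuclideanSpace ℝ (Fin n))))
    (fun φ φ' _ => LinearMap.ext fun g => K1.ext fun _ =>
      (congrArg (· * _) (conv_add_left φ φ' g _)).trans (add_mul _ _ _))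
    (fun c φ _ => LinearMap.ext fun g => K1.ext fun _ =>
      (congrArg (· * _) (conv_smul_left c φ g _)).trans (mul_assoc _ _ _))
    (fun _ ψ ψ' => LinearMap.ext fun _ => K1.ext fun t =>
      (congrArg (_ * ·) (invFourier_add ψ ψ' t)).trans (mul_add _ _ _))
    (fun c _ ψ => LinearMap.ext fun _ => K1.ext fun t =>
      (congrArg (_ * ·) (invFourier_smul c ψ t)).trans (mul_left_comm _ _ _))) :
    K1 ℝ ⊗[ℂ] U n →ₗ[ℂ] K1 ℝ →ₗ[ℂ] K1 (EuclideanSpace ℝ (Fin n)))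

lemma synthesisAlg_tmul (u : EuclideanSpace ℝ (Fin n)) (φ : K1 ℝ) (ψ : U n) (g : K1 ℝ) :
    synthesisAlg u (φ ⊗ₜ[ℂ] ψ : K1 ℝ ⊗[ℂ] U n) g = synthesisSimple u φ ψ g := rfl

/-- A seminorm on `V ⊗ W` that is bounded by `C p(v) q(w)` on simple tensors is bounded by
`C (p ⊗ q)`. -/
lemma seminorm_le_mul_projSeminorm {V W : Type*} [AddCommGroup V] [Module ℂ V] [AddCommGroup W]
    [Module ℂ W] (p : Seminorm ℂ V) (q : Seminorm ℂ W) (r : Seminorm ℂ (V ⊗[ℂ] W)) {C : ℝ}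
    (hC : 0 ≤ C) (h : ∀ v w, r (v ⊗ₜ w) ≤ C * (p v * q w)) (y : V ⊗[ℂ] W) :
    r y ≤ C * projSeminorm p q y := by
  rw [projSeminorm_apply, ← smul_eq_mul, ← Real.sInf_smul_of_nonneg hC]
  refine le_csInf ((projCosts_nonempty p q y).smul_set) ?_
  rintro _ ⟨_, ⟨L, rfl, rfl⟩, rfl⟩
  induction L with
  | nil => simp
  | cons a L ih =>
    simp only [List.map_cons, List.sum_cons, smul_eq_mul, mul_add] at ih ⊢
    exact (map_add_le_add r _ _).trans (add_le_add (h _ _) ih)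

lemma rho_synthesisAlg_le (u : EuclideanSpace ℝ (Fin n)) (y : K1TensorU n) (g : K1 ℝ) (k : ℕ) :
    rho _ k (synthesisAlg u y g)
      ≤ synthesisConst u k * rho ℝ k g * piSeminorm n (1, k + n + 1 + k) y :=
  seminorm_le_mul_projSeminorm (rho ℝ 1) (theta n (k + n + 1 + k))
    ((rho _ k).comp ((synthesisAlg u).flip g))
    (mul_nonneg (synthesisConst_nonneg u k) (apply_nonneg _ _))
    (fun φ ψ => rho_synthesisSimple_le u φ ψ g k) y

lemma continuous_synthesisAlg (u : EuclideanSpace ℝ (Fin n)) :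
    Continuous fun p : K1TensorU n × K1 ℝ => synthesisAlg u p.1 p.2 := by
  refine continuous_iff_continuousAt.2 fun ⟨y₀, g₀⟩ =>
    ((rho_withSeminorms _).tendsto_nhds _ _).2 fun k ε hε => ?_
  set C := synthesisConst u k
  set π := piSeminorm n (1, k + n + 1 + k)
  set b : K1TensorU n × K1 ℝ → ℝ := fun p => C * rho ℝ k p.2 * π (p.1 - y₀) +
    C * rho ℝ k (p.2 - g₀) * π y₀ with hb
  have hbc : Continuous b := by
    have h1 : Continuous π := (piSeminorm_withSeminorms n).continuous_seminorm _
    have h2 : Continuous (rho ℝ k) := (rho_withSeminorms ℝ).continuous_seminorm _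
    fun_prop
  have hb0 : b (y₀, g₀) = 0 := by simp [hb]
  filter_upwards [(hbc.tendsto' _ _ hb0).eventually (gt_mem_nhds hε)] with p hp
  refine lt_of_le_of_lt ?_ hp
  have hsplit : synthesisAlg u p.1 p.2 - synthesisAlg u y₀ g₀
      = synthesisAlg u (p.1 - y₀) p.2 + synthesisAlg u y₀ (p.2 - g₀) := by
    rw [map_sub, map_sub, LinearMap.sub_apply]
    abel
  rw [hsplit]
  exact (map_add_le_add _ _ _).trans
    (add_le_add (rho_synthesisAlg_le u _ _ k) (rho_synthesisAlg_le u _ _ k))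

end Algebraic

/-! ### Decay and continuity of elements of the completed tensor product -/

section Weighted

open scoped BoundedContinuousFunction

variable {n : ℕ}

/-- `(φ ⊗ ψ)(x, ξ)` divided by the weight `(1+x²)⁻¹ (1+|ξ|²)^{-(n+1)/2}`, as a bounded continuous
function of `(ξ, x) ∈ ℝⁿ × ℝ`. -/
def weightedSimple (φ : K1 ℝ) (ψ : U n) : EuclideanSpace ℝ (Fin n) × ℝ →ᵇ ℂ :=
  BoundedContinuousFunction.ofNormedAddCommGroup
    (fun p => ((decay n p.1)⁻¹ * (1 + p.2 ^ 2) : ℝ) * (φ p.2 * ψ (toComplex p.1)))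
    (by
      have h1 := φ.continuous
      have h2 := ψ.continuous
      have h3 : Continuous fun p : EuclideanSpace ℝ (Fin n) × ℝ => (decay n p.1)⁻¹ :=
        (continuous_decay.comp continuous_fst).inv₀ fun p => (decay_pos _).ne'
      fun_prop)
    (2 * (rho ℝ 1 φ * theta n (n + 1) ψ))
    (fun p => by
      have h1 := norm_le_rho_mul_inv φ p.2
      have h2 := norm_toComplex_le_theta_mul_decay ψ le_rfl p.1
      have h3 := decay_pos p.1
      have h4 := apply_nonneg (rho ℝ 1) φ
      rw [norm_mul, norm_mul, Complex.norm_real, Real.norm_of_nonneg (by positivity)]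
      calc _ ≤ (decay n p.1)⁻¹ * (1 + p.2 ^ 2) *
            ((2 * rho ℝ 1 φ * (1 + p.2 ^ 2)⁻¹) * (theta n (n + 1) ψ * decay n p.1)) := by gcongr
        _ = _ := by field_simp)

lemma norm_weightedSimple_le (φ : K1 ℝ) (ψ : U n) :
    ‖weightedSimple φ ψ‖ ≤ 2 * (rho ℝ 1 φ * theta n (n + 1) ψ) :=
  BoundedContinuousFunction.norm_ofNormedAddCommGroup_le _
    (mul_nonneg zero_le_two (mul_nonneg (apply_nonneg _ _) (apply_nonneg _ _))) _

variable (n) in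
/-- Division by the weight `(1+x²)⁻¹ (1+|ξ|²)^{-(n+1)/2}` on the algebraic tensor product. -/
def weightedAlg : K1TensorU n →ₗ[ℂ] (EuclideanSpace ℝ (Fin n) × ℝ →ᵇ ℂ) :=
  (TensorProduct.lift (LinearMap.mk₂ ℂ weightedSimple
    (fun _ _ _ => BoundedContinuousFunction.ext fun _ =>
      (congrArg (_ * ·) (add_mul _ _ _)).trans (mul_add _ _ _))
    (fun _ _ _ => BoundedContinuousFunction.ext fun _ =>
      (congrArg (_ * ·) (mul_assoc _ _ _)).trans (mul_left_comm _ _ _))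
    (fun _ _ _ => BoundedContinuousFunction.ext fun _ =>
      (congrArg (_ * ·) (mul_add _ _ _)).trans (mul_add _ _ _))
    (fun _ _ _ => BoundedContinuousFunction.ext fun _ =>
      (congrArg (_ * ·) (mul_left_comm _ _ _)).trans (mul_left_comm _ _ _))) :
    K1 ℝ ⊗[ℂ] U n →ₗ[ℂ] (EuclideanSpace ℝ (Fin n) × ℝ →ᵇ ℂ))

lemma weightedAlg_apply (y : K1TensorU n) (p : EuclideanSpace ℝ (Fin n) × ℝ) :
    weightedAlg n y p
      = ((decay n p.1)⁻¹ * (1 + p.2 ^ 2) : ℝ) * evalLin p.2 (toComplex p.1) y := by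
  induction y using TensorProduct.induction_on with
  | zero =>
    exact (congrArg (fun f : EuclideanSpace ℝ (Fin n) × ℝ →ᵇ ℂ => f p)
      (map_zero (weightedAlg n))).trans
        ((congrArg (_ * ·) (map_zero (evalLin p.2 (toComplex p.1)))).trans (mul_zero _)).symm
  | tmul φ ψ => rfl
  | add x y hx hy =>
    refine (congrArg (fun f : EuclideanSpace ℝ (Fin n) × ℝ →ᵇ ℂ => f p)
      (map_add (weightedAlg n) x y)).trans ?_
    refine (congrArg₂ (· + ·) hx hy).trans ?_
    rw [← mul_add]
    exact congrArg (_ * ·) (map_add (evalLin p.2 (toComplex p.1)) x y).symm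

lemma norm_weightedAlg_le (y : K1TensorU n) :
    ‖weightedAlg n y‖ ≤ 2 * piSeminorm n (1, n + 1) y :=
  seminorm_le_mul_projSeminorm (rho ℝ 1) (theta n (n + 1))
    ((normSeminorm ℂ _).comp (weightedAlg n)) zero_le_two norm_weightedSimple_le y

lemma continuous_weightedAlg : Continuous (weightedAlg n) :=
  (piSeminorm_withSeminorms n).continuous_normedSpace_rng _ (weightedAlg n)
    ⟨{(1, n + 1)}, 2, fun y => by
      rw [Finset.sup_singleton]
      exact norm_weightedAlg_le y⟩

variable (n) in
/-- The function `(ξ, x) ↦ Φ(x, ξ)` divided by the weight `(1+x²)⁻¹ (1+|ξ|²)^{-(n+1)/2}`, for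
`Φ` in the completed tensor product. -/
def weighted : K1HatU n →L[ℂ] (EuclideanSpace ℝ (Fin n) × ℝ →ᵇ ℂ) :=
  ContinuousLinearMap.fromCompletion ⟨weightedAlg n, continuous_weightedAlg⟩

lemma weighted_coe (y : K1TensorU n) : weighted n (y : K1HatU n) = weightedAlg n y :=
  ContinuousLinearMap.fromCompletion_apply_coe _ _

lemma evalHat_coe (x : ℝ) (z : EuclideanSpace ℂ (Fin n)) (y : K1TensorU n) :
    evalHat x z (y : K1HatU n) = evalLin x z y :=
  ContinuousLinearMap.fromCompletion_apply_coe _ _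

lemma weighted_apply (Φ : K1HatU n) (p : EuclideanSpace ℝ (Fin n) × ℝ) :
    weighted n Φ p = ((decay n p.1)⁻¹ * (1 + p.2 ^ 2) : ℝ) * evalHat p.2 (toComplex p.1) Φ := by
  induction Φ using UniformSpace.Completion.induction_on with
  | hp =>
    refine isClosed_eq ?_ (continuous_const.mul (evalHat _ _).continuous)
    exact (BoundedContinuousFunction.evalCLM ℂ p).continuous.comp (weighted n).continuous
  | ih y => rw [weighted_coe, evalHat_coe, weightedAlg_apply]

lemma evalHat_eq (Φ : K1HatU n) (p : EuclideanSpace ℝ (Fin n) × ℝ) :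
    evalHat p.2 (toComplex p.1) Φ = (decay n p.1 * (1 + p.2 ^ 2)⁻¹ : ℝ) * weighted n Φ p := by
  have h1 := (decay_pos p.1).ne'
  have h2 : (1 + p.2 ^ 2 : ℝ) ≠ 0 := by positivity
  rw [weighted_apply, ← mul_assoc, ← Complex.ofReal_mul]
  have : decay n p.1 * (1 + p.2 ^ 2)⁻¹ * ((decay n p.1)⁻¹ * (1 + p.2 ^ 2)) = 1 := by field_simp
  rw [this, Complex.ofReal_one, one_mul]

end Weighted

/-! ### The synthesis operator on the completed tensor product -/

section Synthesis

variable {n : ℕ} (u : EuclideanSpace ℝ (Fin n)) (g : K1 ℝ) (Φ : K1HatU n)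
  (t : EuclideanSpace ℝ (Fin n))

lemma norm_synthesisKernel_le (p : EuclideanSpace ℝ (Fin n) × ℝ) :
    ‖synthesisKernel u g Φ t p.1 p.2‖
      ≤ decay n p.1 * (1 + p.2 ^ 2)⁻¹ * (‖weighted n Φ‖ * rho ℝ 0 g) := by
  have h := decay_pos p.1
  rw [synthesisKernel, evalHat_eq, norm_mul, norm_mul, norm_mul, norm_cexp_two_pi_I_mul_ofReal,
    mul_one, Complex.norm_real, Real.norm_of_nonneg (by positivity), mul_assoc]
  gcongr
  · exact (weighted n Φ).norm_coe_le_norm p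
  · exact norm_apply_le_rho g _

variable (n) in
lemma integrable_decay_mul_inv : Integrable fun p : EuclideanSpace ℝ (Fin n) × ℝ =>
    decay n p.1 * (1 + p.2 ^ 2)⁻¹ :=
  integrable_decay.mul_prod integrable_inv_one_add_sq

lemma integrable_synthesisKernel :
    Integrable fun p : EuclideanSpace ℝ (Fin n) × ℝ => synthesisKernel u g Φ t p.1 p.2 := by
  refine ((integrable_decay_mul_inv n).mul_const _).mono' ?_
    (Eventually.of_forall (norm_synthesisKernel_le u g Φ t))
  unfold synthesisKernel
  simp_rw [evalHat_eq]
  have h1 := g.continuous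
  have h2 := continuous_decay (n := n)
  have h3 : Continuous fun p : EuclideanSpace ℝ (Fin n) × ℝ => (1 + p.2 ^ 2)⁻¹ :=
    Continuous.inv₀ (by fun_prop) fun p => by positivity
  exact (by fun_prop : Continuous _).aestronglyMeasurable

lemma synthesis_eq_integral_prod :
    synthesis u g Φ t
      = ∫ p : EuclideanSpace ℝ (Fin n) × ℝ, synthesisKernel u g Φ t p.1 p.2 :=
  (integral_prod _ (integrable_synthesisKernel u g Φ t)).symm

lemma synthesis_add_left (Φ' : K1HatU n) :
    synthesis u g (Φ + Φ') t = synthesis u g Φ t + synthesis u g Φ' t := by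
  simp only [synthesis_eq_integral_prod]
  rw [← integral_add (integrable_synthesisKernel u g Φ t) (integrable_synthesisKernel u g Φ' t)]
  refine integral_congr_ae (Eventually.of_forall fun p => ?_)
  simp only [synthesisKernel, map_add]
  ring

lemma synthesis_smul_left (c : ℂ) : synthesis u g (c • Φ) t = c * synthesis u g Φ t := by
  simp only [synthesis_eq_integral_prod]
  rw [← integral_const_mul]
  refine integral_congr_ae (Eventually.of_forall fun p => ?_)
  simp only [synthesisKernel, map_smul, smul_eq_mul]
  ring

lemma synthesis_add_right (g' : K1 ℝ) :
    synthesis u (g + g') Φ t = synthesis u g Φ t + synthesis u g' Φ t := by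
  simp only [synthesis_eq_integral_prod]
  rw [← integral_add (integrable_synthesisKernel u g Φ t) (integrable_synthesisKernel u g' Φ t)]
  refine integral_congr_ae (Eventually.of_forall fun p => ?_)
  have h (s : ℝ) : (g + g') s = g s + g' s := rfl
  simp only [synthesisKernel, h]
  ring

lemma synthesis_smul_right (c : ℂ) : synthesis u (c • g) Φ t = c * synthesis u g Φ t := by
  simp only [synthesis_eq_integral_prod]
  rw [← integral_const_mul]
  refine integral_congr_ae (Eventually.of_forall fun p => ?_)
  have h (s : ℝ) : (c • g) s = c * g s := rfl
  simp only [synthesisKernel, h]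
  ring

lemma continuous_synthesis : Continuous fun Φ : K1HatU n => synthesis u g Φ t := by
  let S : K1HatU n →ₗ[ℂ] ℂ :=
    { toFun := fun Φ => synthesis u g Φ t
      map_add' := fun Φ Φ' => synthesis_add_left u g Φ t Φ'
      map_smul' := fun c Φ => synthesis_smul_left u g Φ t c }
  have hbound : ∀ Φ, ‖S Φ‖ ≤ (∫ p : EuclideanSpace ℝ (Fin n) × ℝ,
      decay n p.1 * (1 + p.2 ^ 2)⁻¹) * (‖weighted n Φ‖ * rho ℝ 0 g) := fun Φ => by
    change ‖synthesis u g Φ t‖ ≤ _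
    rw [synthesis_eq_integral_prod, ← integral_mul_const]
    exact norm_integral_le_of_norm_le ((integrable_decay_mul_inv n).mul_const _)
      (Eventually.of_forall (norm_synthesisKernel_le u g Φ t))
  refine continuous_of_continuousAt_zero S ?_
  rw [ContinuousAt, map_zero]
  refine squeeze_zero_norm hbound ?_
  refine Continuous.tendsto' ?_ _ _ (by simp)
  have := (weighted n).continuous
  fun_prop

/-- On the algebraic tensor product the two descriptions of the synthesis operator agree. -/
lemma synthesis_coe (y : K1TensorU n) :
    synthesis u g (y : K1HatU n) t = synthesisAlg u y g t := by
  induction y using TensorProduct.induction_on with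
  | zero =>
    have h : synthesis u g ((0 : K1TensorU n) : K1HatU n) t = synthesisAlg u 0 g t := by
      rw [UniformSpace.Completion.coe_zero, map_zero, LinearMap.zero_apply]
      simpa using! synthesis_smul_left u g 0 t 0
    exact h
  | tmul φ ψ =>
    rw [synthesisAlg_tmul, synthesisSimple_apply, synthesis, invFourier, ← integral_const_mul]
    refine integral_congr_ae (Eventually.of_forall fun ξ => ?_)
    simp only [synthesisKernel, evalHat_tmul, conv]
    rw [← integral_mul_const]
    refine integral_congr_ae (Eventually.of_forall fun x => ?_)
    ring
  | add x y hx hy =>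
    have h : ∀ x y : K1TensorU n, synthesis u g (x : K1HatU n) t = synthesisAlg u x g t →
        synthesis u g (y : K1HatU n) t = synthesisAlg u y g t →
        synthesis u g ((x + y : K1TensorU n) : K1HatU n) t = synthesisAlg u (x + y) g t := by
      intro x y hx hy
      rw [UniformSpace.Completion.coe_add, synthesis_add_left, hx, hy, map_add]
      rfl
    exact h x y hx hy

/-- The synthesis operator takes values in `𝒦₁(ℝⁿ)` and is jointly continuous: it is the extension
by continuity of the jointly continuous bilinear map on the algebraic tensor product. -/
lemma exists_continuous_eq_synthesis :
    ∃ F : K1HatU n × K1 ℝ → K1 (EuclideanSpace ℝ (Fin n)), Continuous F ∧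
      ∀ Φ g t, F (Φ, g) t = synthesis u g Φ t := by
  have de : IsDenseInducing (UniformSpace.Completion.toCompl : K1TensorU n →+ K1HatU n) :=
    UniformSpace.Completion.isDenseInducing_coe
  have df : IsDenseInducing (AddMonoidHom.id (K1 ℝ)) :=
    ⟨Topology.IsInducing.id, Function.surjective_id.denseRange⟩
  let B : K1TensorU n →+ K1 ℝ →+ K1 (EuclideanSpace ℝ (Fin n)) :=
    AddMonoidHom.mk' (fun y => (synthesisAlg u y).toAddMonoidHom) fun y y' => by
      ext1 g
      exact congrArg (· g) (map_add (synthesisAlg u) y y')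
  have hB : Continuous fun p : K1TensorU n × K1 ℝ => B p.1 p.2 := continuous_synthesisAlg u
  have hF := de.extend_Z_bilin df hB
  refine ⟨_, hF, fun Φ g t => ?_⟩
  induction Φ using UniformSpace.Completion.induction_on with
  | hp =>
    refine isClosed_eq ?_ (continuous_synthesis u g t)
    exact (K1.continuous_evalₗ t).comp (hF.comp (by fun_prop))
  | ih y =>
    rw [synthesis_coe]
    exact congrArg (fun φ : K1 _ => φ t) ((de.prodMap df).extend_eq hB (y, g))

end Synthesis

end DSTFT

end

theorem mainTheorem6 {n : ℕ} (u : EuclideanSpace ℝ (Fin n)) (hu : ‖u‖ = 1) :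
    (∀ (Φ : DSTFT.K1HatU n) (g : DSTFT.K1 ℝ) (t : EuclideanSpace ℝ (Fin n)),
      MeasureTheory.Integrable
        (fun p : EuclideanSpace ℝ (Fin n) × ℝ => DSTFT.synthesisKernel u g Φ t p.1 p.2)) ∧
    ∃ DSstar : DSTFT.K1HatU n →ₗ[ℂ] DSTFT.K1 ℝ →ₗ[ℂ] DSTFT.K1 (EuclideanSpace ℝ (Fin n)),
      (∀ (Φ : DSTFT.K1HatU n) (g : DSTFT.K1 ℝ) (t : EuclideanSpace ℝ (Fin n)),
        DSstar Φ g t = DSTFT.synthesis u g Φ t) ∧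
      Continuous fun p : DSTFT.K1HatU n × DSTFT.K1 ℝ => DSstar p.1 p.2 := by
  refine ⟨fun Φ g t => DSTFT.integrable_synthesisKernel u g Φ t, ?_⟩
  obtain ⟨F, hFc, hF⟩ := DSTFT.exists_continuous_eq_synthesis u
  refine ⟨LinearMap.mk₂ ℂ (fun Φ g => F (Φ, g)) (fun Φ Φ' g => DSTFT.K1.ext fun t => ?_)
    (fun c Φ g => DSTFT.K1.ext fun t => ?_) (fun Φ g g' => DSTFT.K1.ext fun t => ?_)
    (fun c Φ g => DSTFT.K1.ext fun t => ?_), hF, hFc⟩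
  · refine (hF _ _ _).trans ((DSTFT.synthesis_add_left u g Φ t Φ').trans ?_)
    exact (congrArg₂ (· + ·) (hF Φ g t) (hF Φ' g t)).symm
  · refine (hF _ _ _).trans ((DSTFT.synthesis_smul_left u g Φ t c).trans ?_)
    exact (congrArg (c * ·) (hF Φ g t)).symm
  · refine (hF _ _ _).trans ((DSTFT.synthesis_add_right u g Φ t g').trans ?_)
    exact (congrArg₂ (· + ·) (hF Φ g t) (hF Φ g' t)).symm
  · refine (hF _ _ _).trans ((DSTFT.synthesis_smul_right u g Φ t c).trans ?_)
    exact (congrArg (c * ·) (hF Φ g t)).symm
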